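/- **Rank-one constructions.** Let $h_0\ge 1$ be an integer, $(r_j)_{j\ge0}$ positive integers with $r_j\to\infty$, and $s_j(i)\ge 0$ integers ($j\ge 0$, $1\le i\le r_j$); put $h_{j+1}=r_jh_j+\sum_{i=1}^{r_j}s_j(i)$. An invertible map $T:X\to X$, $X\subset\mathbb R$ with Lebesgue measure $\mu$, is the rank-one transformation with these parameters if there are half-open intervals $C_j$ such that for every $j$: the floors $C_j,TC_j,\dots,T^{h_j-1}C_j$ of the $j$-th tower are disjoint half-open intervals of the same length, each of which except the last is translated by $T$ onto the next one; $C_j$ is the disjoint union of half-open intervals $C_j^1,\dots,C_j^{r_j}$ of equal length with $C_{j+1}=C_j^1$ and $T^{h_j+s_j(i)}C_j^i=C_j^{i+1}$ for $i<r_j$; and $X$ is the union of all floors of all towers. **Notation.** We also write $T$ for the operator $f\mapsto f\circ T$ on $L_2(\mu)$. $T$ is rigid if $T^{n_i}\to I$ strongly for some $n_i\to\infty$. For a prime $q$ let $S_q$ be the shift $z\mapsto z+1$ of $\mathbb Z/q$, and let $\hat S_{(p)}=\prod_{q\ne p}S_q$ (product over all primes $q\neq p$), acting on the compact group $\prod_{q\neq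 p}\mathbb Z/q$ with its normalized Haar measure; likewise $\prod_qS_q$ is the product over all primes. A measure preserving map has exactly $n$ ergodic components if, up to null sets, the space is a disjoint union of $n$ invariant sets of positive measure on each of which the map is ergodic. **Theorem.** Let $J\subset\{0,1,2,\dots\}$ be any infinite set with infinite complement. There are an infinite set $J'$ disjoint from $J$ and parameters $h_0,r_j,s_j(i)$ as above with * $s_j(i)=0$ for all $1\le i\le r_j$, if $j\in J$; * $r_j=2(j+1)$, $s_j(i)=0$ for $1\le i\le j+1$ and $s_j(i)=h_j$ for $j+2\le i\le 2(j+1)$, if $j\in J'$, and a rank-one transformation $T$ with these parameters which is an automorphism (an invertible measure preserving transformation) of a space $(X,\mu)$ of infinite $\sigma$-finite measure, such that: 1. $T^{h_j}\to I$ strongly as $j\to\infty$, $j\in J$; in particular, $T$ is rigid; 2. $T^{h_j}\to \frac12 I$ weakly as $j\to\infty$, $j\in J'$; in particular, for some $0<a<1$ and some $m_i\to\infty$, $T^{m_i}\to aI$ weakly; 3. for every ergodic automorphism $S$ of a standard probability space with discrete spectrum whose eigenvalues are exactly the numbers $\exp(2\pi i k/(p_1p_2\cdots p_n))$, where $k\in\mathbb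 Z$ and $p_1,\dots,p_n$ are distinct primes, in particular for $S=\prod_qS_q$, and for every prime $p$, the power $(S\times T)^p=S^p\times T^p$ has exactly $p$ ergodic components; 4. for every prime $p$, the product $\hat S_{(p)}\times T^p$ is ergodic. -/

import Mathlib

open MeasureTheory Filter Topology

noncomputable section

/-! ### Koopman operators, rigidity, ergodic components -/

/-- The operator `f ↦ f ∘ T` on `L²(μ)` (real or complex) of a measure preserving map `T`. -/
def koopman (𝕜 : Type*) [RCLike 𝕜] {X : Type*} [MeasurableSpace X] {μ : Measure X} (T : X → X)
    (hT : MeasurePreserving T μ μ) : Lp 𝕜 2 μ →L[𝕜] Lp 𝕜 2 μ :=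
  (Lp.compMeasurePreservingₗᵢ 𝕜 T hT).toContinuousLinearMap

/-- `T^{n_i} → I` in the strong operator topology, along the filter `l`. -/
def TendstoId {X : Type*} [MeasurableSpace X] {μ : Measure X} (T : X → X)
    (hT : MeasurePreserving T μ μ) {ι : Type*} (n : ι → ℕ) (l : Filter ι) : Prop :=
  ∀ f : Lp ℝ 2 μ, Tendsto (fun i => (koopman ℝ T hT ^ n i) f) l (𝓝 f)

/-- `T^{n_i} → a I` in the weak operator topology, along the filter `l`. -/
def TendstoWeaklySmul {X : Type*} [MeasurableSpace X] {μ : Measure X} (T : X → X)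
    (hT : MeasurePreserving T μ μ) {ι : Type*} (n : ι → ℕ) (l : Filter ι) (a : ℝ) : Prop :=
  ∀ f g : Lp ℝ 2 μ,
    Tendsto (fun i => inner ℝ ((koopman ℝ T hT ^ n i) f) g) l (𝓝 (a * inner ℝ f g))

/-- Rigidity: `T^{n_i} → I` strongly for some sequence `n_i → ∞`. -/
def IsRigid {X : Type*} [MeasurableSpace X] {μ : Measure X} (T : X → X)
    (hT : MeasurePreserving T μ μ) : Prop :=
  ∃ n : ℕ → ℕ, Tendsto n atTop atTop ∧ TendstoId T hT n atTop

/-- `R` has exactly `n` ergodic components: up to null sets the space is a disjoint union of `n`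
invariant sets of positive measure, on each of which `R` is ergodic. -/
def HasExactlyErgodicComponents {X : Type*} [MeasurableSpace X] (R : X → X) (μ : Measure X)
    (n : ℕ) : Prop :=
  ∃ A : Fin n → Set X,
    (∀ i, MeasurableSet (A i)) ∧
    (∀ i j, i ≠ j → μ (A i ∩ A j) = 0) ∧
    μ (⋃ i, A i)ᶜ = 0 ∧
    ∀ i, μ (A i) ≠ 0 ∧ R ⁻¹' A i =ᵐ[μ] A i ∧ Ergodic R (μ.restrict (A i))

/-! ### Automorphisms with square-free rational spectrum -/

/-- `S` is an ergodic automorphism with discrete spectrum, whose group of eigenvalues consists of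
all `exp (2 π i k / (p₁ ⋯ pₙ))`, where `p₁, …, pₙ` are distinct primes and `k` is an integer. -/
structure HasSquarefreeRationalSpectrum {Z : Type*} [MeasurableSpace Z] (S : Z ≃ᵐ Z)
    (ν : Measure Z) : Prop where
  ergodic : Ergodic S ν
  discrete : (⨆ z : ℂ, Module.End.eigenspace
      (koopman ℂ S ergodic.toMeasurePreserving : Lp ℂ 2 ν →ₗ[ℂ] Lp ℂ 2 ν) z).topologicalClosure = ⊤
  eigenvalues : {z : ℂ | Module.End.HasEigenvalue
      (koopman ℂ S ergodic.toMeasurePreserving : Lp ℂ 2 ν →ₗ[ℂ] Lp ℂ 2 ν) z} =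
    {z : ℂ | ∃ (F : Finset Nat.Primes) (k : ℤ),
      z = Complex.exp (2 * Real.pi * Complex.I * k / ∏ p ∈ F, ((p : ℕ) : ℂ))}

/-- The compact group `∏_{q ∈ Q} ℤ/q`, for a set `Q` of primes. -/
abbrev PrimeProduct (Q : Set Nat.Primes) : Type := ∀ q : Q, ZMod ((q : Nat.Primes) : ℕ)

instance isProbabilityMeasure_uniformOn_zmod (q : Nat.Primes) :
    IsProbabilityMeasure (ProbabilityTheory.uniformOn (Set.univ : Set (ZMod (q : ℕ)))) :=
  haveI : NeZero (q : ℕ) := ⟨q.2.ne_zero⟩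
  ProbabilityTheory.isProbabilityMeasure_uniformOn Set.finite_univ Set.univ_nonempty

/-- The normalized Haar measure of `∏_{q ∈ Q} ℤ/q`: the product of the uniform measures. -/
def primeHaar (Q : Set Nat.Primes) : Measure (PrimeProduct Q) :=
  Measure.infinitePi fun q : Q =>
    ProbabilityTheory.uniformOn (Set.univ : Set (ZMod ((q : Nat.Primes) : ℕ)))

instance isProbabilityMeasure_primeHaar (Q : Set Nat.Primes) :
    IsProbabilityMeasure (primeHaar Q) := by
  unfold primeHaar; infer_instance

/-- The product `∏_{q ∈ Q} S_q`, where `S_q` is the shift `z ↦ z + 1` of `ℤ/q`. -/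
def primeShift (Q : Set Nat.Primes) (x : PrimeProduct Q) : PrimeProduct Q := fun q => x q + 1

/-! ### Rank-one constructions -/

/-- The parameters of a rank-one construction. Stages are numbered by `j = 0, 1, 2, …` and the
columns of the `j`-th tower by `i = 0, …, r j - 1`; the values `s j i` with `r j ≤ i` are not
used. -/
structure RankOneParams where
  /-- height of the initial tower -/
  h₀ : ℕ
  /-- numbers of columns -/
  r : ℕ → ℕ
  /-- numbers of spacers put above the columns -/
  s : ℕ → ℕ → ℕ
  h₀_pos : 0 < h₀
  r_pos : ∀ j, 0 < r j
  r_tendsto : Tendsto r atTop atTop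

namespace RankOneParams

/-- The height of the `j`-th tower. -/
def h (P : RankOneParams) : ℕ → ℕ
  | 0 => P.h₀
  | j + 1 => h P j * P.r j + ∑ i ∈ Finset.range (P.r j), P.s j i

/-- The number, among the floors of tower `j + 1`, of the bottom floor of the `i`-th column of
tower `j`. -/
def offset (P : RankOneParams) (j i : ℕ) : ℕ :=
  i * P.h j + ∑ k ∈ Finset.range i, P.s j k

end RankOneParams

/-- Lebesgue measure on a subset of the line. -/
def lebesgueOn (X : Set ℝ) : Measure X := Measure.comap Subtype.val volume

/-- `T : X → X` is obtained by the cutting-and-stacking (rank-one) construction with parameters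
`P`. The `k`-th floor of the `j`-th tower, `k < P.h j`, is the half-open interval
`[a j k, a j k + w j)`. -/
structure IsRankOneConstruction (P : RankOneParams) (X : Set ℝ) (T : X ≃ᵐ X)
    (a : ℕ → ℕ → ℝ) (w : ℕ → ℝ) : Prop where
  width_pos : ∀ j, 0 < w j
  width_succ : ∀ j, w (j + 1) = w j / P.r j
  /-- the floors of a tower are disjoint -/
  disjoint : ∀ j, (Set.Iio (P.h j)).PairwiseDisjoint fun k => Set.Ico (a j k) (a j k + w j)
  /-- the base of tower `j` is cut into the bases of its `r j` columns, which are floors of tower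
  `j + 1`; the base of the first column is the base of tower `j + 1`, as `offset j 0 = 0` -/
  cut : ∀ j, ⋃ i ∈ Set.Iio (P.r j),
      Set.Ico (a (j + 1) (P.offset j i)) (a (j + 1) (P.offset j i) + w (j + 1)) =
    Set.Ico (a j 0) (a j 0 + w j)
  /-- `T` translates every floor of a tower, except the top one, onto the next floor -/
  translation : ∀ j k, k + 1 < P.h j → ∀ x : X, (x : ℝ) ∈ Set.Ico (a j k) (a j k + w j) →
    (T x : ℝ) = x + (a j (k + 1) - a j k)
  /-- the space is the union of all towers -/
  union : ⋃ j, ⋃ k ∈ Set.Iio (P.h j), Set.Ico (a j k) (a j k + w j) = X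

/-- The conditions on the base automorphism `T`: it is rigid, `T^{m_i} → a I` weakly for some
`0 < a < 1` and `m_i → ∞`, and for every automorphism `S` of a standard probability space with the
square-free rational spectrum and every prime `p`, the power `(S × T)^p` has exactly `p` ergodic
components. -/
structure IsSuitableBase {X : Type*} [MeasurableSpace X] {μ : Measure X} (T : X → X)
    (hT : MeasurePreserving T μ μ) : Prop where
  rigid : IsRigid T hT
  weak_limit : ∃ a : ℝ, 0 < a ∧ a < 1 ∧ ∃ m : ℕ → ℕ, Tendsto m atTop atTop ∧
    TendstoWeaklySmul T hT m atTop a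
  components : ∀ (Z : Type) [MeasurableSpace Z] [StandardBorelSpace Z] (ν : Measure Z)
    [IsProbabilityMeasure ν] (S : Z ≃ᵐ Z), HasSquarefreeRationalSpectrum S ν →
    ∀ p : ℕ, p.Prime → HasExactlyErgodicComponents (Prod.map S T)^[p] (ν.prod μ) p

end

noncomputable section

/-! ### Invariant sets of products -/

section Products

variable {Z X : Type*} [MeasurableSpace Z] [MeasurableSpace X] {ν : Measure Z} {μ : Measure X}

/-! Statements 3 and 4 rest on one property of `T`: total ergodicity, that is, ergodicity of every
power `T^N` with `N ≥ 1`. The complement of `J` is split into two infinite sets, `J'` and a set of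
free stages. A free stage has `(j + 2)!` columns whose bottoms are `h_j (j + 2)! + 1` apart. For `N
≤ j + 2` the offset of column `i` is then congruent to `i` modulo `N`, and `N` divides the number of
columns, so the pieces of each floor of tower `j` are equidistributed modulo `N` among the floors of
tower `j + 1`. A `T^N`-invariant set has equal measure in floors of one tower with congruent
numbers. Hence, if it fills more than half of a single floor of tower `j + 1`, it fills at least the
fraction `1 / (2N)` of every floor of tower `j`. By Lebesgue density, an invariant set and its
complement cannot both have positive measure (`ergodic_iterate_transformation`). The free stages
also make the total measure infinite.

Now let `E` be invariant under the product of a power `R` of `S` with a power of `T`. If `φ` is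
`R^m`-invariant, the integral of `φ` over the section of `E` at `x` is invariant under a power of
`T`, hence constant (`ae_const_setIntegral_section`). Such periodic `φ` are total in `L²`, because
the eigenvalues of `S` are roots of unity; for products of cyclic shifts, cylinders play this role.
So `E` is a cylinder over the first factor (`exists_ae_eq_fst_preimage_of_ae_const`), and the
product has the ergodic components of `R`. For `R = S^p` there are `p` of them, the level sets of an
eigenfunction with eigenvalue `exp(2πi/p)`; for `R` equal to the product of the `S_q` with `q ≠ p`
there is one, whatever power of `T` is taken.

The limits along heights are read off the towers. Without spacers, `T^{h_j}` moves each floor of a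
column onto the same floor of the next column, so only the last column is lost. At a stage in `J'`
one half of the columns behaves in this way, and the other half is lifted into the spacers, away
from tower `j`; this gives the factor `1/2`. -/

/-- If all sections of a set `E` have, a.e., the same measure inside every measurable set, then
`E` is a cylinder modulo null sets. -/
theorem exists_ae_eq_fst_preimage_of_ae_const [IsProbabilityMeasure ν] [SigmaFinite μ]
    {E : Set (Z × X)} (hE : MeasurableSet E)
    (h : ∀ A : Set Z, MeasurableSet A →
      ∃ C, ∀ᵐ x ∂μ, ν (A ∩ (fun z => (z, x)) ⁻¹' E) = C) :
    ∃ B : Set Z, MeasurableSet B ∧ E =ᵐ[ν.prod μ] (Prod.fst ⁻¹' B : Set (Z × X)) := by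
  rcases eq_or_ne μ 0 with rfl | hμ
  · exact ⟨∅, MeasurableSet.empty, by simp [Filter.EventuallyEq]⟩
  obtain ⟨D, hD, -, hD0, hDtop⟩ := μ.exists_subset_measure_lt_top MeasurableSet.univ
    (r := 0) (by simpa [pos_iff_ne_zero] using hμ)
  have key : ∀ A : Set Z, MeasurableSet A → ∃ C, C ≤ ν A ∧ ∀ t : Set X, MeasurableSet t →
      (ν.prod μ) (E ∩ A ×ˢ t) = C * μ t := by
    intro A hA
    obtain ⟨C, hC⟩ := h A hA
    have : (ae μ).NeBot := ae_neBot.2 hμ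
    obtain ⟨x, hx⟩ := hC.exists
    refine ⟨C, hx ▸ measure_mono Set.inter_subset_left, fun t ht => ?_⟩
    rw [Measure.prod_apply_symm (hE.inter (hA.prod ht))]
    have : (fun x => ν ((fun z => (z, x)) ⁻¹' (E ∩ A ×ˢ t))) =ᵐ[μ] t.indicator fun _ => C := by
      filter_upwards [hC] with x hx
      by_cases hxt : x ∈ t
      · rw [Set.indicator_of_mem hxt, ← hx]
        congr 1
        ext z
        simp [hxt, and_comm]
      · rw [Set.indicator_of_notMem hxt]
        have : (fun z => (z, x)) ⁻¹' (E ∩ A ×ˢ t) = (∅ : Set Z) := by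
          ext z; simp [hxt]
        rw [this, measure_empty]
    rw [lintegral_congr_ae this, lintegral_indicator ht, setLIntegral_const]
  -- `ν' A` is the common value of the measures of `A ∩ E_x`, written so that it is visibly a
  -- measure in `A`. The measures `ν' × μ` and `(ν × μ)|_E` agree on rectangles, so the density of
  -- `ν'`, a function of `z` alone, equals the indicator of `E`.
  set ν' : Measure Z := (μ D)⁻¹ • ((ν.prod μ).restrict (E ∩ Set.univ ×ˢ D)).map Prod.fst with hν'
  have hν'_apply : ∀ A, MeasurableSet A → ν' A = (μ D)⁻¹ * (ν.prod μ) (E ∩ A ×ˢ D) := by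
    intro A hA
    rw [hν', Measure.smul_apply, Measure.map_apply measurable_fst hA,
      Measure.restrict_apply (measurable_fst hA), smul_eq_mul]
    congr 2
    ext ⟨z, x⟩
    simp only [Set.mem_inter_iff, Set.mem_preimage, Set.mem_prod, Set.mem_univ, true_and]
    tauto
  have hcan : ∀ C : ENNReal, (μ D)⁻¹ * (C * μ D) = C := fun C => by
    rw [mul_comm C, ← mul_assoc, ENNReal.inv_mul_cancel hD0.ne' hDtop.ne, one_mul]
  have hle : ν' ≤ ν := by
    refine Measure.le_iff.2 fun A hA => ?_
    obtain ⟨C, hCν, hC⟩ := key A hA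
    rwa [hν'_apply A hA, hC D hD, hcan]
  have : IsFiniteMeasure ν' := isFiniteMeasure_of_le ν hle
  have hprod : ν'.prod μ = (ν.prod μ).restrict E := by
    refine Measure.prod_eq fun A t hA ht => ?_
    obtain ⟨C, hCν, hC⟩ := key A hA
    rw [hν'_apply A hA, hC D hD, hcan, Measure.restrict_apply (hA.prod ht), Set.inter_comm, hC t ht]
  have hg : Measurable (ν'.rnDeriv ν) := Measure.measurable_rnDeriv _ _
  rw [← Measure.withDensity_rnDeriv_eq ν' ν (Measure.absolutelyContinuous_of_le hle),
    prod_withDensity_left hg, ← withDensity_indicator_one hE] at hprod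
  have hprod' := (withDensity_eq_iff_of_sigmaFinite (f := fun z : Z × X => ν'.rnDeriv ν z.1)
    (hg.comp measurable_fst).aemeasurable (measurable_one.indicator hE).aemeasurable).1 hprod
  refine ⟨{z | ν'.rnDeriv ν z ≠ 0}, hg (measurableSet_singleton 0).compl, ?_⟩
  filter_upwards [hprod'] with p hp
  change (p ∈ E) = (ν'.rnDeriv ν p.1 ≠ 0)
  rw [hp]
  by_cases hpE : p ∈ E <;> simp [hpE]

/-- Periodic functions have a.e. constant integrals over the sections of an invariant set of
`S × T`, if all powers of `T` are ergodic. -/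
theorem ae_const_setIntegral_section [IsProbabilityMeasure ν] [SigmaFinite μ] {S : Z → Z}
    {T : X → X} (hS : MeasurePreserving S ν ν) (hT : ∀ n, 0 < n → Ergodic T^[n] μ)
    {E : Set (Z × X)} (hE : MeasurableSet E) (hinv : Prod.map S T ⁻¹' E = E) {φ : Z → ℂ}
    (hφ : AEStronglyMeasurable φ ν) {m : ℕ} (hm : 0 < m) (hφS : φ ∘ S^[m] =ᵐ[ν] φ) :
    ∃ C : ℂ, ∀ᵐ x ∂μ, ∫ z in (fun z => (z, x)) ⁻¹' E, φ z ∂ν = C := by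
  have hsec : ∀ x, MeasurableSet ((fun z => (z, x)) ⁻¹' E) := fun x =>
    hE.preimage measurable_prodMk_right
  set c : X → ℂ := fun x => ∫ z in (fun z => (z, x)) ⁻¹' E, φ z ∂ν with hc
  have hcm : AEStronglyMeasurable c μ := by
    have h1 : AEStronglyMeasurable (fun p : X × Z => (Prod.swap ⁻¹' E).indicator (fun p => φ p.2) p)
        (μ.prod ν) := (hφ.comp_snd).indicator (hE.preimage measurable_swap)
    refine h1.integral_prod_right'.congr (ae_of_all _ fun x => ?_)
    simp only [hc]
    rw [← integral_indicator (hsec x)]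
    rfl
  have hEm : ∀ z x, (S^[m] z, T^[m] x) ∈ E ↔ (z, x) ∈ E := by
    intro z x
    have : (Prod.map S T)^[m] ⁻¹' E = E := by
      clear hm hφS
      induction m with
      | zero => rfl
      | succ n ih => rw [Function.iterate_succ', Set.preimage_comp, hinv, ih]
    rw [Prod.map_iterate] at this
    exact Set.ext_iff.1 this (z, x)
  -- The substitution `z ↦ S^m z` turns the section of `E` at `T^m x` into the section at `x`, and
  -- it leaves `φ` unchanged.
  have hcT : c ∘ T^[m] = c := by
    funext x
    have hSm := hS.iterate m
    simp only [hc, Function.comp_apply]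
    rw [← integral_indicator (hsec _), ← integral_indicator (hsec _)]
    have h2 : AEStronglyMeasurable (((fun z => (z, T^[m] x)) ⁻¹' E).indicator φ)
        (ν.map S^[m]) := by
      rw [hSm.map_eq]; exact hφ.indicator (hsec _)
    conv_lhs => rw [← hSm.map_eq]
    rw [integral_map hSm.aemeasurable h2]
    refine integral_congr_ae ?_
    filter_upwards [hφS] with z hz
    by_cases hzx : (z, x) ∈ E
    · rw [Set.indicator_of_mem (show z ∈ (fun z => (z, x)) ⁻¹' E from hzx),
        Set.indicator_of_mem (show S^[m] z ∈ (fun z => (z, T^[m] x)) ⁻¹' E from (hEm z x).2 hzx)]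
      exact hz
    · rw [Set.indicator_of_notMem (show z ∉ (fun z => (z, x)) ⁻¹' E from hzx),
        Set.indicator_of_notMem
          (show S^[m] z ∉ (fun z => (z, T^[m] x)) ⁻¹' E from fun h => hzx ((hEm z x).1 h))]
  exact (hT m hm).ae_eq_const_of_ae_eq_comp_ae hcm (ae_of_all _ fun x => congrFun hcT x)

theorem ae_const_measure_of_ae_const_setIntegral [IsProbabilityMeasure ν] {E : Set (Z × X)}
    {A : Set Z} (hA : MeasurableSet A)
    (h : ∃ C : ℂ, ∀ᵐ x ∂μ, ∫ z in (fun z => (z, x)) ⁻¹' E, A.indicator 1 z ∂ν = C) :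
    ∃ C, ∀ᵐ x ∂μ, ν (A ∩ (fun z => (z, x)) ⁻¹' E) = C := by
  obtain ⟨C, hC⟩ := h
  refine ⟨ENNReal.ofReal C.re, ?_⟩
  filter_upwards [hC] with x hx
  rw [integral_indicator hA, Measure.restrict_restrict hA] at hx
  simp only [Pi.one_apply, integral_const, measureReal_restrict_apply_univ, Complex.real_smul,
    mul_one] at hx
  rw [← hx, Complex.ofReal_re, ofReal_measureReal]

/-- A product inherits the ergodic components of its first factor, if its invariant sets are
cylinders over that factor. -/
theorem HasExactlyErgodicComponents.prod [IsProbabilityMeasure ν] [SigmaFinite μ] (hμ : μ ≠ 0)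
    {S : Z → Z} {T : X → X} {n : ℕ} (hS : MeasurePreserving S ν ν) (hT : MeasurePreserving T μ μ)
    (hn : HasExactlyErgodicComponents S ν n)
    (h : ∀ E, MeasurableSet E → Prod.map S T ⁻¹' E = E →
      ∃ B : Set Z, MeasurableSet B ∧ E =ᵐ[ν.prod μ] (Prod.fst ⁻¹' B : Set (Z × X))) :
    HasExactlyErgodicComponents (Prod.map S T) (ν.prod μ) n := by
  obtain ⟨A, hA, hdisj, hcov, hcomp⟩ := hn
  have hq : Measure.QuasiMeasurePreserving (Prod.fst : Z × X → Z) (ν.prod μ) ν :=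
    Measure.quasiMeasurePreserving_fst
  have hfst : ∀ B : Set Z, (ν.prod μ) (Prod.fst ⁻¹' B) = 0 ↔ ν B = 0 := by
    intro B
    rw [← Set.prod_univ, Measure.prod_prod, mul_eq_zero, Measure.measure_univ_eq_zero]
    tauto
  have hST := hS.prod hT
  refine ⟨fun i => Prod.fst ⁻¹' A i, fun i => measurable_fst (hA i), fun i j hij => ?_, ?_,
    fun i => ?_⟩
  · rw [← Set.preimage_inter, hfst]; exact hdisj i j hij
  · rw [← Set.preimage_iUnion, ← Set.preimage_compl, hfst]; exact hcov
  obtain ⟨h0, hinv, herg⟩ := hcomp i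
  have hinv' : Prod.map S T ⁻¹' (Prod.fst ⁻¹' A i) =ᵐ[ν.prod μ] (Prod.fst ⁻¹' A i : Set (Z × X)) :=
    hq.preimage_ae_eq hinv
  refine ⟨fun h' => h0 ((hfst _).1 h'), hinv', ?_⟩
  refine ⟨?_, ⟨fun E hE hinvE => ?_⟩⟩
  · have := hST.restrict_preimage (measurable_fst (hA i))
    rwa [Measure.restrict_congr_set hinv'] at this
  -- Ergodicity on the component is tested on sets that are invariant in the whole space, so `h`
  -- applies to `E` itself.
  obtain ⟨B, hB, hEB⟩ := h E hE hinvE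
  have hBinv : S ⁻¹' B =ᵐ[ν] B := by
    have h1 : Prod.map S T ⁻¹' E =ᵐ[ν.prod μ] Prod.map S T ⁻¹' (Prod.fst ⁻¹' B) :=
      hST.quasiMeasurePreserving.preimage_ae_eq hEB
    rw [hinvE] at h1
    have h2 := h1.symm.trans hEB
    rw [ae_eq_set] at h2 ⊢
    have e : Prod.map S T ⁻¹' (Prod.fst ⁻¹' B) = (Prod.fst ⁻¹' (S ⁻¹' B) : Set (Z × X)) := rfl
    rw [e, ← Set.preimage_sdiff, ← Set.preimage_sdiff, hfst, hfst] at h2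
    exact h2
  have hBc := herg.quasiErgodic.aeconst_set₀ hB.nullMeasurableSet
    (ae_restrict_of_ae hBinv)
  have hEB' : E =ᵐ[(ν.prod μ).restrict (Prod.fst ⁻¹' A i)] (Prod.fst ⁻¹' B : Set (Z × X)) :=
    ae_restrict_of_ae hEB
  refine EventuallyConst.congr ?_ hEB'.symm
  have : (ν.prod μ).restrict (Prod.fst ⁻¹' A i) = (ν.restrict (A i)).prod μ := by
    rw [← Set.prod_univ, ← Measure.prod_restrict, Measure.restrict_univ]
  rw [this]
  rw [eventuallyConst_set] at hBc ⊢
  have hq' : Measure.QuasiMeasurePreserving (Prod.fst : Z × X → Z) ((ν.restrict (A i)).prod μ)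
    (ν.restrict (A i)) := Measure.quasiMeasurePreserving_fst
  exact hBc.imp (fun h => hq'.ae h) fun h => hq'.ae h

/-- The product with an ergodic map is ergodic, if its invariant sets are cylinders over that
factor. -/
theorem Ergodic.prod_of_fst_preimage [IsProbabilityMeasure ν] [SigmaFinite μ] (hμ : μ ≠ 0)
    {S : Z → Z} {T : X → X} (hS : Ergodic S ν) (hT : MeasurePreserving T μ μ)
    (h : ∀ E, MeasurableSet E → Prod.map S T ⁻¹' E = E →
      ∃ B : Set Z, MeasurableSet B ∧ E =ᵐ[ν.prod μ] (Prod.fst ⁻¹' B : Set (Z × X))) :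
    Ergodic (Prod.map S T) (ν.prod μ) := by
  have h1 : HasExactlyErgodicComponents S ν 1 :=
    ⟨fun _ => Set.univ, fun _ => MeasurableSet.univ, fun i j hij => absurd (Subsingleton.elim i j) hij,
      by rw [Set.iUnion_const]; simp, fun i => ⟨by simp, by simp, by simpa using hS⟩⟩
  obtain ⟨A, hA, -, hcov, hcomp⟩ := h1.prod hμ hS.toMeasurePreserving hT h
  have h2 := (hcomp 0).2.2
  rwa [Measure.restrict_eq_self_of_ae_mem] at h2
  rw [ae_iff]
  simpa [Set.compl_def] using hcov

end Products

/-- If an ergodic map permutes cyclically `p` sets that partition the space, then these sets are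
the ergodic components of its `p`-th power. -/
theorem Ergodic.hasExactlyErgodicComponents_iterate {Z : Type*} [MeasurableSpace Z]
    {ν : Measure Z} [IsProbabilityMeasure ν] {S : Z → Z} (hS : Ergodic S ν) {p : ℕ} (hp : 0 < p)
    {A : ℕ → Set Z} (hA : ∀ i, MeasurableSet (A i)) (hper : ∀ i, A (i + p) = A i)
    (hshift : ∀ i, S ⁻¹' A (i + 1) =ᵐ[ν] A i)
    (hdisj : ∀ i k, 0 < k → k < p → ν (A i ∩ A (i + k)) = 0)
    (hcov : ∀ᵐ z ∂ν, ∃ i < p, z ∈ A i) :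
    HasExactlyErgodicComponents S^[p] ν p := by
  have hSm := hS.toMeasurePreserving
  have hiter : ∀ k i, S^[k] ⁻¹' A (i + k) =ᵐ[ν] A i := by
    intro k
    induction k with
    | zero => exact fun i => Filter.EventuallyEq.rfl
    | succ k ih =>
      intro i
      rw [Function.iterate_succ', Set.preimage_comp, ← add_assoc]
      exact ((hSm.iterate k).quasiMeasurePreserving.preimage_ae_eq (hshift (i + k))).trans (ih i)
  have hinv : ∀ i, S^[p] ⁻¹' A i =ᵐ[ν] A i := fun i => by
    have := hiter p i; rwa [hper] at this
  have hmeas : ∀ i, ν (A i) = ν (A 0) := by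
    intro i
    have := measure_congr (hiter i 0)
    rw [zero_add, (hSm.iterate i).measure_preimage (hA i).nullMeasurableSet] at this
    exact this
  refine ⟨fun i => A i, fun i => hA i, fun i j hij => ?_, ?_, fun i => ⟨fun h0 => ?_, hinv i, ?_⟩⟩
  · have aux : ∀ i j : ℕ, i < j → j < p → ν (A i ∩ A j) = 0 := fun i j h1 h2 => by
      have := hdisj i (j - i) (by omega) (by omega)
      rwa [Nat.add_sub_cancel' h1.le] at this
    rcases lt_or_gt_of_ne (Fin.val_ne_of_ne hij) with h | h
    · exact aux _ _ h j.2
    · rw [Set.inter_comm]; exact aux _ _ h i.2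
  · rw [← mem_ae_iff]
    filter_upwards [hcov] with z hz
    obtain ⟨i, hi, hz⟩ := hz
    exact Set.mem_iUnion.2 ⟨⟨i, hi⟩, hz⟩
  -- All `A i` have equal measure; if one were null, the space would be null.
  · have h1 : ν (⋃ i, A i) = 0 := measure_iUnion_null fun j => by rw [hmeas, ← hmeas i, h0]
    have h2 : ∀ᵐ z ∂ν, False := by
      filter_upwards [hcov, measure_eq_zero_iff_ae_notMem.1 h1] with z ⟨j, _, hz⟩ hz'
      exact hz' (Set.mem_iUnion.2 ⟨j, hz⟩)
    simp [ae_iff] at h2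
  refine ⟨?_, ⟨fun B hB hBinv => ?_⟩⟩
  · have := (hSm.iterate p).restrict_preimage (hA i)
    rwa [Measure.restrict_congr_set (hinv i)] at this
  set G : Set Z := B ∩ A i with hG
  have hGm : MeasurableSet G := hB.inter (hA i)
  have hGinv : S^[p] ⁻¹' G =ᵐ[ν] G := by
    rw [hG, Set.preimage_inter, hBinv]
    exact Filter.EventuallyEq.rfl.inter (hinv i)
  -- Saturating `G` under `S` needs only `p` steps, because `G` is invariant under `S^p`. Ergodicity
  -- of `S` then makes `D` null or conull; in the second case a point of `A i` can reach `G ⊆ A i`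
  -- only at time `0`, so it lies in `B`.
  set D : Set Z := {z | ∃ k < p, S^[k] z ∈ G} with hD
  have hDm : MeasurableSet D := by
    have : D = ⋃ k ∈ Set.Iio p, S^[k] ⁻¹' G := by ext z; simp [hD]
    rw [this]
    exact MeasurableSet.biUnion (Set.to_countable _) fun k _ => (hSm.measurable.iterate k) hGm
  have hDinv : S ⁻¹' D =ᵐ[ν] D := by
    filter_upwards [hGinv] with z hz
    have hz' : S^[p] z ∈ G ↔ z ∈ G := iff_of_eq hz
    apply propext
    constructor
    · rintro ⟨k, hk, hkG⟩
      rw [← Function.iterate_succ_apply] at hkG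
      rcases Nat.lt_or_ge (k + 1) p with h | h
      · exact ⟨k + 1, h, hkG⟩
      · have : k + 1 = p := by omega
        rw [Nat.succ_eq_add_one, this, hz'] at hkG
        exact ⟨0, hp, hkG⟩
    · rintro ⟨k, hk, hkG⟩
      rcases Nat.eq_zero_or_pos k with rfl | h
      · refine ⟨p - 1, by omega, ?_⟩
        rw [← Function.iterate_succ_apply, Nat.succ_eq_add_one, Nat.sub_add_cancel hp, hz']
        exact hkG
      · refine ⟨k - 1, by omega, ?_⟩
        rwa [← Function.iterate_succ_apply, Nat.succ_eq_add_one, Nat.sub_add_cancel h]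
  rw [eventuallyConst_set]
  rcases hS.quasiErgodic.ae_empty_or_univ₀ hDm.nullMeasurableSet hDinv with h | h
  · right
    rw [ae_restrict_iff' (hA i)]
    filter_upwards [h] with z hz hzA hzB
    have hz' : z ∈ D ↔ False := iff_of_eq hz
    exact hz'.1 ⟨0, hp, hzB, hzA⟩
  · left
    rw [ae_restrict_iff' (hA i)]
    have hoff : ∀ᵐ z ∂ν, ∀ k, 0 < k → k < p → z ∈ A i → S^[k] z ∉ A i := by
      rw [ae_all_iff]; intro k
      by_cases hk : 0 < k ∧ k < p
      -- `i + (p - k)` stands for `i - k` modulo `p`, the index of the set that `S^k` sends into `A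
      -- i`.
      · have h1 := hiter k (i + (p - k))
        rw [add_assoc, Nat.sub_add_cancel hk.2.le, hper] at h1
        have h2 := hdisj i (p - k) (by omega) (by omega)
        filter_upwards [h1, measure_eq_zero_iff_ae_notMem.1 h2] with z hz hz' _ _ hzA hzk
        exact hz' ⟨hzA, (iff_of_eq hz).1 hzk⟩
      · exact ae_of_all _ fun z h1 h2 => absurd ⟨h1, h2⟩ hk
    filter_upwards [h, hoff] with z hz hzoff hzA
    have hz' : z ∈ D := (iff_of_eq hz).2 trivial
    obtain ⟨k, hk, hkG⟩ := hz'
    rcases Nat.eq_zero_or_pos k with rfl | h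
    · exact hkG.1
    · exact absurd hkG.2 (hzoff k h hk hzA)

/-! ### Products of cyclic shifts -/

section PrimeShift

theorem measurePreserving_add_one_zmod (q : Nat.Primes) :
    MeasurePreserving (fun z : ZMod (q : ℕ) => z + 1)
      (ProbabilityTheory.uniformOn (Set.univ : Set (ZMod (q : ℕ))))
      (ProbabilityTheory.uniformOn (Set.univ : Set (ZMod (q : ℕ)))) := by
  have : NeZero (q : ℕ) := ⟨q.2.ne_zero⟩
  refine ⟨measurable_of_countable _, Measure.ext fun s hs => ?_⟩
  rw [Measure.map_apply (measurable_of_countable _) hs]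
  have h : ∀ t : Set (ZMod (q : ℕ)), ProbabilityTheory.uniformOn Set.univ t
      = Measure.count t / Fintype.card (ZMod (q : ℕ)) := fun t =>
    ProbabilityTheory.uniformOn_univ
  rw [h, h]
  congr 1
  have e : (fun z : ZMod (q : ℕ) => z + 1) = Equiv.addRight (1 : ZMod (q : ℕ)) := rfl
  rw [e, ← Equiv.image_symm_eq_preimage, Measure.count_injective_image (Equiv.injective _)]

variable (Q : Set Nat.Primes)

theorem measurePreserving_primeShift :
    MeasurePreserving (primeShift Q) (primeHaar Q) (primeHaar Q) := by
  have hm : ∀ q : Q, Measurable fun z : ZMod ((q : Nat.Primes) : ℕ) => z + 1 := fun q =>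
    (measurePreserving_add_one_zmod q).measurable
  refine ⟨measurable_pi_lambda _ fun q => (hm q).comp (measurable_pi_apply q), ?_⟩
  have := Measure.infinitePi_map_pi (fun q : Q =>
    ProbabilityTheory.uniformOn (Set.univ : Set (ZMod ((q : Nat.Primes) : ℕ)))) hm
  unfold primeHaar primeShift
  rw [this]
  congr 1
  funext q
  exact (measurePreserving_add_one_zmod q).map_eq

variable {Q}

theorem primeShift_iterate_apply (n : ℕ) (x : PrimeProduct Q) (q : Q) :
    (primeShift Q)^[n] x q = x q + n := by
  induction n with
  | zero => simp
  | succ n ih =>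
    rw [Function.iterate_succ_apply', primeShift, ih]
    push_cast
    ring

/-- Cylinders over finitely many coordinates are invariant under a power of the shift. -/
theorem exists_primeShift_iterate_preimage_cylinder (F : Finset Q)
    (B : Set (∀ q : F, ZMod ((q : Nat.Primes) : ℕ))) :
    ∃ m, 0 < m ∧ ∀ p, ((primeShift Q)^[p])^[m] ⁻¹' cylinder F B = cylinder F B := by
  refine ⟨∏ q ∈ F, ((q : Nat.Primes) : ℕ), Finset.prod_pos fun q _ => q.1.2.pos, fun p => ?_⟩
  ext x
  simp only [Set.mem_preimage, mem_cylinder]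
  have : F.restrict (((primeShift Q)^[p])^[∏ q ∈ F, ((q : Nat.Primes) : ℕ)] x) = F.restrict x := by
    funext q
    simp only [Finset.restrict]
    rw [← Function.iterate_mul, primeShift_iterate_apply]
    have : ((p * ∏ q ∈ F, ((q : Nat.Primes) : ℕ) : ℕ) : ZMod ((q : Nat.Primes) : ℕ)) = 0 :=
      (ZMod.natCast_eq_zero_iff _ _).2 ((Finset.dvd_prod_of_mem _ q.2).mul_left p)
    rw [this, add_zero]
  rw [this]

/-- Chinese remainder theorem for distinct primes: the iterates of the shift act transitively on any
finite set of coordinates. -/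
theorem exists_primeShift_iterate_eq (F : Finset Q)
    (c d : ∀ q : F, ZMod ((q : Nat.Primes) : ℕ)) : ∃ n : ℕ, ∀ q : F, c q + n = d q := by
  obtain ⟨n, hn⟩ := Nat.chineseRemainderOfFinset
    (fun q : F => (d q - c q).val) (fun q : F => ((q : Nat.Primes) : ℕ)) Finset.univ
    (fun q _ => (q : Nat.Primes).2.ne_zero) (fun q _ q' _ hqq => by
      refine (Nat.coprime_primes (q : Nat.Primes).2 (q' : Nat.Primes).2).2 fun h => hqq ?_
      exact Subtype.ext (Subtype.ext (Subtype.ext h)))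
  refine ⟨n, fun q => ?_⟩
  have : NeZero ((q : Nat.Primes) : ℕ) := ⟨(q : Nat.Primes).2.ne_zero⟩
  have h := (ZMod.natCast_eq_natCast_iff _ _ _).2 (hn q (Finset.mem_univ _))
  rw [h, ZMod.natCast_zmod_val]
  ring

/-- By transitivity on finitely many coordinates, an invariant set `D` has the same measure in all
point cylinders over these coordinates. Hence it is independent of every cylinder, so of every
measurable set, and in particular of itself: its measure equals its own square. -/
theorem ergodic_primeShift : Ergodic (primeShift Q) (primeHaar Q) := by
  have hS := measurePreserving_primeShift Q
  refine ⟨hS, ⟨fun D hD hinv => ?_⟩⟩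
  have hinvn : ∀ n, (primeShift Q)^[n] ⁻¹' D = D := fun n => by
    induction n with
    | zero => rfl
    | succ n ih => rw [Function.iterate_succ', Set.preimage_comp, hinv, ih]
  have hfin : ∀ F : Finset Q, Finite (∀ q : F, ZMod ((q : Nat.Primes) : ℕ)) := fun F => by
    have : ∀ q : F, NeZero ((q : Nat.Primes) : ℕ) := fun q => ⟨(q : Nat.Primes).2.ne_zero⟩
    infer_instance
  have hcylm : ∀ (F : Finset Q) (B : Set (∀ q : F, ZMod ((q : Nat.Primes) : ℕ))),
      MeasurableSet (cylinder (α := fun q : Q => ZMod ((q : Nat.Primes) : ℕ)) F B) := fun F B =>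
    MeasurableSet.cylinder _ (Set.to_countable B).measurableSet
  have hpt : ∀ (F : Finset Q) (D : Set (PrimeProduct Q)), MeasurableSet D →
      (∀ n, (primeShift Q)^[n] ⁻¹' D = D) → ∀ c d,
      primeHaar Q (D ∩ cylinder F {c}) = primeHaar Q (D ∩ cylinder F {d}) := by
    intro F D hD hinvn c d
    obtain ⟨n, hn⟩ := exists_primeShift_iterate_eq F c d
    rw [← (hS.iterate n).measure_preimage (hD.inter (hcylm F {d})).nullMeasurableSet,
      Set.preimage_inter, hinvn]
    congr 2
    ext x
    simp only [mem_cylinder, Set.mem_singleton_iff, Set.mem_preimage, funext_iff, Finset.restrict,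
      primeShift_iterate_apply]
    refine forall_congr' fun q => ?_
    rw [← hn q]
    exact (add_left_inj _).symm
  have hsum : ∀ (F : Finset Q) (D : Set (PrimeProduct Q)), MeasurableSet D →
      (∀ n, (primeShift Q)^[n] ⁻¹' D = D) →
      ∀ (B : Set (∀ q : F, ZMod ((q : Nat.Primes) : ℕ))) c,
      primeHaar Q (D ∩ cylinder F B) = B.ncard * primeHaar Q (D ∩ cylinder F {c}) := by
    intro F D hD hinvn B c
    have := hfin F
    have e : D ∩ cylinder F B = ⋃ b ∈ B.toFinite.toFinset, D ∩ cylinder F {b} := by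
      ext x
      simp only [mem_cylinder, Set.mem_inter_iff, Set.mem_iUnion, Set.Finite.mem_toFinset,
        Set.mem_singleton_iff, exists_prop]
      exact ⟨fun h => ⟨_, h.2, h.1, rfl⟩, fun ⟨b, hb, h1, h2⟩ => ⟨h1, h2 ▸ hb⟩⟩
    rw [e, measure_biUnion_finset _ fun b _ => hD.inter (hcylm F {b})]
    · rw [Finset.sum_congr rfl fun b _ => hpt F D hD hinvn b c, Finset.sum_const, nsmul_eq_mul,
        Set.ncard_eq_toFinset_card B]
    · intro b _ b' _ hbb
      refine Set.disjoint_left.2 fun x hx hx' => hbb ?_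
      exact (Set.mem_singleton_iff.1 ((mem_cylinder _ _ _).1 hx.2)).symm.trans
        (Set.mem_singleton_iff.1 ((mem_cylinder _ _ _).1 hx'.2))
  have hind : ∀ A ∈ measurableCylinders (fun q : Q => ZMod ((q : Nat.Primes) : ℕ)),
      primeHaar Q (D ∩ A) = primeHaar Q D * primeHaar Q A := by
    intro A hA
    obtain ⟨F, B, -, rfl⟩ := (mem_measurableCylinders A).1 hA
    have := hfin F
    have c : ∀ q : F, ZMod ((q : Nat.Primes) : ℕ) := fun _ => 0
    have h1 := hsum F D hD hinvn B c
    have h2 := hsum F D hD hinvn Set.univ c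
    have h3 := hsum F Set.univ MeasurableSet.univ (fun _ => rfl) B c
    have h4 := hsum F Set.univ MeasurableSet.univ (fun _ => rfl) Set.univ c
    simp only [cylinder_univ, Set.inter_univ, Set.univ_inter, measure_univ] at h1 h2 h3 h4
    rw [h1, h2, h3]
    calc _ = (B.ncard * primeHaar Q (D ∩ cylinder F {c})) * 1 := (mul_one _).symm
      _ = _ := by rw [h4]; ring
  have hall : (primeHaar Q).restrict D = primeHaar Q D • primeHaar Q := by
    have : IsFiniteMeasure (primeHaar Q D • primeHaar Q) :=
      ⟨by simp [measure_lt_top]⟩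
    refine ext_of_generate_finite (measurableCylinders fun q : Q => ZMod ((q : Nat.Primes) : ℕ))
      generateFrom_measurableCylinders.symm isPiSystem_measurableCylinders (fun A hA => ?_) (by simp)
    rw [Measure.restrict_apply (MeasurableSet.of_mem_measurableCylinders hA), Set.inter_comm,
      hind A hA]
    rfl
  have h0 : primeHaar Q D = primeHaar Q D * primeHaar Q D := by
    have := congrArg (fun m => m D) hall
    simpa [Measure.restrict_apply hD] using this
  rw [eventuallyConst_set]
  rcases eq_or_ne (primeHaar Q D) 0 with h | h
  · exact Or.inr (measure_eq_zero_iff_ae_notMem.1 h)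
  · left
    exact (prob_compl_eq_zero_iff hD).2 ((ENNReal.mul_eq_left h (measure_ne_top _ _)).1 h0.symm)

/-- The invariant sets of the product of a power of the shift with a totally ergodic map are
cylinders. -/
theorem exists_fst_preimage_of_primeShift {X : Type*} [MeasurableSpace X] {μ : Measure X}
    [SigmaFinite μ] {T : X → X} (hT : ∀ n, 0 < n → Ergodic T^[n] μ) (p : ℕ)
    {E : Set (PrimeProduct Q × X)} (hE : MeasurableSet E)
    (hinv : Prod.map (primeShift Q)^[p] T ⁻¹' E = E) :
    ∃ B : Set (PrimeProduct Q), MeasurableSet B ∧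
      E =ᵐ[(primeHaar Q).prod μ] (Prod.fst ⁻¹' B : Set (PrimeProduct Q × X)) := by
  refine exists_ae_eq_fst_preimage_of_ae_const hE fun A hA => ?_
  have hS := (measurePreserving_primeShift Q).iterate p
  have hsec : ∀ x, MeasurableSet ((fun z => (z, x)) ⁻¹' E) := fun x =>
    hE.preimage measurable_prodMk_right
  have hper : ∀ A : Set (PrimeProduct Q), MeasurableSet A → ∀ m, 0 < m →
      ((primeShift Q)^[p])^[m] ⁻¹' A = A →
      ∃ C, ∀ᵐ x ∂μ, primeHaar Q (A ∩ (fun z => (z, x)) ⁻¹' E) = C := by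
    intro A hA m hm hAm
    refine ae_const_measure_of_ae_const_setIntegral hA
      (ae_const_setIntegral_section hS hT hE hinv (m := m)
        (measurable_one.indicator hA).aestronglyMeasurable hm (ae_of_all _ fun z => ?_))
    have : ((primeShift Q)^[p])^[m] z ∈ A ↔ z ∈ A := Set.ext_iff.1 hAm z
    by_cases h : z ∈ A
    · simp [h, this.2 h]
    · simp [h, mt this.1 h]
  -- `C₁` is the measure of a full section; it is needed for complements in the π-λ induction, which
  -- starts from the periodic cylinders.
  obtain ⟨C₁, hC₁⟩ := hper Set.univ MeasurableSet.univ 1 one_pos rfl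
  induction A, hA using MeasurableSpace.induction_on_inter
    generateFrom_measurableCylinders.symm isPiSystem_measurableCylinders with
  | empty => exact ⟨0, by simp⟩
  | basic A hA =>
    obtain ⟨F, B, -, rfl⟩ := (mem_measurableCylinders A).1 hA
    obtain ⟨m, hm, h⟩ := exists_primeShift_iterate_preimage_cylinder F B
    exact hper _ (MeasurableSet.of_mem_measurableCylinders hA) m hm (h p)
  | compl A hA ih =>
    obtain ⟨C, hC⟩ := ih
    refine ⟨C₁ - C, ?_⟩
    filter_upwards [hC, hC₁] with x hx hx₁
    rw [← hx, ← hx₁, ← measure_sdiff (Set.inter_subset_inter_left _ (Set.subset_univ _))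
      (hA.inter (hsec x)).nullMeasurableSet (measure_ne_top _ _)]
    congr 1
    ext z
    simp only [Set.mem_inter_iff, Set.mem_compl_iff, Set.mem_univ, true_and, Set.mem_sdiff]
    tauto
  | iUnion f hd hf ih =>
    choose C hC using ih
    refine ⟨∑' i, C i, ?_⟩
    filter_upwards [ae_all_iff.2 hC] with x hx
    rw [Set.iUnion_inter, measure_iUnion _ fun i => (hf i).inter (hsec x), tsum_congr hx]
    exact fun i j hij => (hd hij).mono Set.inter_subset_left Set.inter_subset_left

/-- The components are the fibres of the coordinate at `p`, which the shift permutes cyclically. -/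
theorem hasExactlyErgodicComponents_primeShift_iterate (p : Nat.Primes) :
    HasExactlyErgodicComponents (primeShift Set.univ)^[(p : ℕ)] (primeHaar Set.univ) p := by
  let p' : (Set.univ : Set Nat.Primes) := ⟨p, trivial⟩
  have : NeZero (p : ℕ) := ⟨p.2.ne_zero⟩
  refine ergodic_primeShift.hasExactlyErgodicComponents_iterate p.2.pos
    (A := fun i => {x | x p' = (i : ZMod (p : ℕ))}) (fun i => ?_) (fun i => ?_) (fun i => ?_)
    (fun i k h1 h2 => ?_) (ae_of_all _ fun x => ?_)
  · exact measurable_pi_apply p' (measurableSet_singleton _)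
  · ext x; simp
  · refine Filter.EventuallyEq.of_eq ?_
    ext x
    simp [primeShift]
  · convert measure_empty (μ := primeHaar Set.univ)
    ext x
    simp only [Set.mem_inter_iff, Set.mem_ofPred_eq, Set.mem_empty_iff_false, iff_false, not_and]
    intro h h'
    rw [h, Nat.cast_add, left_eq_add, ZMod.natCast_eq_zero_iff] at h'
    exact absurd (Nat.le_of_dvd h1 h') (by omega)
  · exact ⟨(x p').val, ZMod.val_lt (x p'), (ZMod.natCast_zmod_val (x p')).symm⟩

end PrimeShift

/-! ### Automorphisms with square-free rational spectrum -/

section Spectrum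

variable {Z : Type*} [MeasurableSpace Z] {ν : Measure Z}

theorem comp_ae_eq_of_mem_eigenspace_koopman {S : Z → Z} (hS : MeasurePreserving S ν ν) {z : ℂ}
    {φ : Lp ℂ 2 ν}
    (h : φ ∈ Module.End.eigenspace (koopman ℂ S hS : Lp ℂ 2 ν →ₗ[ℂ] Lp ℂ 2 ν) z) :
    φ ∘ S =ᵐ[ν] fun x => z * φ x := by
  have h1 : koopman ℂ S hS φ = z • φ := Module.End.mem_eigenspace_iff.1 h
  have h2 : (koopman ℂ S hS φ : Z → ℂ) =ᵐ[ν] φ ∘ S := Lp.coeFn_compMeasurePreserving φ hS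
  rw [h1] at h2
  filter_upwards [h2, Lp.coeFn_smul z φ] with x hx hx'
  rw [← hx, hx']
  rfl

theorem comp_iterate_ae_eq_of_comp_ae_eq {S : Z → Z} (hS : MeasurePreserving S ν ν) {z : ℂ}
    {φ : Z → ℂ} (h : φ ∘ S =ᵐ[ν] fun x => z * φ x) (n : ℕ) :
    φ ∘ S^[n] =ᵐ[ν] fun x => z ^ n * φ x := by
  induction n with
  | zero => exact ae_of_all _ fun x => by simp
  | succ n ih =>
    filter_upwards [h, hS.quasiMeasurePreserving.ae_eq_comp ih] with x hx hx'
    simp only [Function.comp_apply] at hx hx' ⊢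
    rw [Function.iterate_succ_apply, hx', hx]
    ring

/-- Since the eigenvalues are roots of unity, every eigenfunction is fixed by some positive power of
`S`. No more than this is needed to show that invariant sets are cylinders. -/
theorem exp_squarefree_pow_eq_one (F : Finset Nat.Primes) (k : ℤ) :
    Complex.exp (2 * Real.pi * Complex.I * k / ∏ p ∈ F, ((p : ℕ) : ℂ)) ^ (∏ p ∈ F, (p : ℕ)) = 1 := by
  rw [← Complex.exp_nat_mul]
  refine Complex.exp_eq_one_iff.2 ⟨k, ?_⟩
  have : (∏ p ∈ F, ((p : ℕ) : ℂ)) ≠ 0 :=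
    Finset.prod_ne_zero_iff.2 fun p _ => Nat.cast_ne_zero.2 p.2.ne_zero
  push_cast
  field_simp

/-- The invariant sets of the product of a power of `S` with a totally ergodic map are
cylinders, if `S` has square-free rational spectrum. -/
theorem HasSquarefreeRationalSpectrum.exists_fst_preimage [IsProbabilityMeasure ν] {S : Z ≃ᵐ Z}
    (hS : HasSquarefreeRationalSpectrum S ν) {X : Type*} [MeasurableSpace X] {μ : Measure X}
    [SigmaFinite μ] {T : X → X} (hT : ∀ n, 0 < n → Ergodic T^[n] μ) (p : ℕ)
    {E : Set (Z × X)} (hE : MeasurableSet E) (hinv : Prod.map S^[p] T ⁻¹' E = E) :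
    ∃ B : Set Z, MeasurableSet B ∧ E =ᵐ[ν.prod μ] (Prod.fst ⁻¹' B : Set (Z × X)) := by
  rcases eq_or_ne μ 0 with rfl | hμ
  · exact ⟨∅, MeasurableSet.empty, by simp [Filter.EventuallyEq]⟩
  have hμ' : (ae μ).NeBot := ae_neBot.2 hμ
  have hSm := hS.ergodic.toMeasurePreserving
  have hsec : ∀ x, MeasurableSet ((fun z => (z, x)) ⁻¹' E) := fun x =>
    hE.preimage measurable_prodMk_right
  let e : X → Lp ℂ 2 ν := fun x => indicatorConstLp 2 (hsec x) (measure_ne_top ν _) 1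
  have he : ∀ x (φ : Lp ℂ 2 ν), inner ℂ (e x) φ = ∫ z in (fun z => (z, x)) ⁻¹' E, φ z ∂ν :=
    fun x φ => L2.inner_indicatorConstLp_one (hsec x) _ φ
  -- `V` is a closed subspace containing all eigenfunctions, hence everything. It is closed because
  -- countably many exceptional null sets can be discarded together, after which the limit of the
  -- constants does not depend on `x`.
  let V : Submodule ℂ (Lp ℂ 2 ν) :=
    { carrier := {φ | ∃ C, ∀ᵐ x ∂μ, inner ℂ (e x) φ = C}
      add_mem' := by
        rintro φ ψ ⟨C, hC⟩ ⟨D, hD⟩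
        refine ⟨C + D, ?_⟩
        filter_upwards [hC, hD] with x hx hx'
        rw [inner_add_right, hx, hx']
      zero_mem' := ⟨0, ae_of_all _ fun x => inner_zero_right _⟩
      smul_mem' := by
        rintro a φ ⟨C, hC⟩
        refine ⟨a * C, ?_⟩
        filter_upwards [hC] with x hx
        rw [inner_smul_right, hx] }
  have hVclosed : IsClosed (V : Set (Lp ℂ 2 ν)) := by
    refine isClosed_of_closure_subset fun φ hφ => ?_
    obtain ⟨f, hf, hlim⟩ := mem_closure_iff_seq_limit.1 hφ
    choose C hC using hf
    have hall := ae_all_iff.2 hC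
    have hx : ∀ x, (∀ n, inner ℂ (e x) (f n) = C n) → Tendsto C atTop (𝓝 (inner ℂ (e x) φ)) := by
      intro x hx
      have h := ((continuous_const.inner continuous_id :
        Continuous fun ψ : Lp ℂ 2 ν => inner ℂ (e x) ψ).tendsto φ).comp hlim
      exact h.congr hx
    obtain ⟨x₀, hx₀⟩ := hall.exists
    refine ⟨inner ℂ (e x₀) φ, ?_⟩
    filter_upwards [hall] with x h
    exact tendsto_nhds_unique (hx x h) (hx x₀ hx₀)
  have hVtop : V = ⊤ := by
    refine top_le_iff.1 ?_
    rw [← hS.discrete]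
    refine Submodule.topologicalClosure_minimal _ (iSup_le fun z φ hφ => ?_) hVclosed
    rcases eq_or_ne φ 0 with rfl | h0
    · exact V.zero_mem
    have hz : z ∈ {z : ℂ | Module.End.HasEigenvalue
        (koopman ℂ S hS.ergodic.toMeasurePreserving : Lp ℂ 2 ν →ₗ[ℂ] Lp ℂ 2 ν) z} :=
      Module.End.hasEigenvalue_of_hasEigenvector ⟨hφ, h0⟩
    rw [hS.eigenvalues] at hz
    obtain ⟨F, k, rfl⟩ := hz
    have h1 := comp_iterate_ae_eq_of_comp_ae_eq hSm
      (comp_ae_eq_of_mem_eigenspace_koopman hSm hφ) (p * ∏ q ∈ F, (q : ℕ))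
    rw [mul_comm p, pow_mul, exp_squarefree_pow_eq_one, mul_comm _ p, Function.iterate_mul] at h1
    simp only [one_pow, one_mul] at h1
    obtain ⟨C, hC⟩ := ae_const_setIntegral_section (hSm.iterate p) hT hE hinv
      (Lp.aestronglyMeasurable φ) (Finset.prod_pos fun q _ => q.2.pos) h1
    refine ⟨C, ?_⟩
    filter_upwards [hC] with x hx
    rw [he, hx]
  refine exists_ae_eq_fst_preimage_of_ae_const hE fun A hA =>
    ae_const_measure_of_ae_const_setIntegral hA ?_
  have hmem : indicatorConstLp 2 hA (measure_ne_top ν A) (1 : ℂ) ∈ V := hVtop ▸ Submodule.mem_top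
  obtain ⟨C, hC⟩ := hmem
  refine ⟨C, ?_⟩
  filter_upwards [hC] with x hx
  rw [← hx, he]
  refine integral_congr_ae (ae_restrict_of_ae ?_)
  filter_upwards [indicatorConstLp_coeFn (p := 2) (hs := hA) (hμs := measure_ne_top ν A)
    (c := (1 : ℂ))] with z hz
  rw [hz]
  rfl

/-- For an eigenfunction `φ` with eigenvalue `ζ = exp(2πi/p)` the power `φ^p` is invariant, so it is
a constant `d^p ≠ 0`. Thus `φ` takes only the values `ζ^i d`, and its level sets are permuted
cyclically by `S`. -/
theorem HasSquarefreeRationalSpectrum.hasExactlyErgodicComponents_iterate [IsProbabilityMeasure ν]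
    {S : Z ≃ᵐ Z} (hS : HasSquarefreeRationalSpectrum S ν) {p : ℕ} (hp : p.Prime) :
    HasExactlyErgodicComponents S^[p] ν p := by
  have hSm := hS.ergodic.toMeasurePreserving
  set ζ : ℂ := Complex.exp (2 * Real.pi * Complex.I / p) with hζ
  have hprim : IsPrimitiveRoot ζ p := Complex.isPrimitiveRoot_exp p hp.ne_zero
  have hζ0 : ζ ≠ 0 := Complex.exp_ne_zero _
  have hmem : ζ ∈ {z : ℂ | ∃ (F : Finset Nat.Primes) (k : ℤ),
      z = Complex.exp (2 * Real.pi * Complex.I * k / ∏ p ∈ F, ((p : ℕ) : ℂ))} :=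
    ⟨{(show Nat.Primes from ⟨p, hp⟩)}, 1, by
      rw [Finset.prod_singleton, Int.cast_one, mul_one]⟩
  rw [← hS.eigenvalues] at hmem
  obtain ⟨φ, hφ, hφ0⟩ := Module.End.HasEigenvalue.exists_hasEigenvector hmem
  have hφS := comp_ae_eq_of_mem_eigenspace_koopman hSm hφ
  have hφm : Measurable φ := (Lp.stronglyMeasurable φ).measurable
  obtain ⟨c, hc⟩ := hS.ergodic.ae_eq_const_of_ae_eq_comp₀ (g := fun x => φ x ^ p)
    (hφm.pow_const p).nullMeasurable (by
      filter_upwards [hφS] with x hx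
      simp only [Function.comp_apply] at hx ⊢
      rw [hx, mul_pow, hprim.pow_eq_one, one_mul])
  have hc0 : c ≠ 0 := by
    rintro rfl
    refine hφ0 ((Lp.eq_zero_iff_ae_eq_zero).2 ?_)
    filter_upwards [hc] with x hx
    exact eq_zero_of_pow_eq_zero hx
  obtain ⟨d, hd⟩ := IsAlgClosed.exists_pow_nat_eq c hp.pos
  have hd0 : d ≠ 0 := by
    rintro rfl
    exact hc0 (by rw [← hd, zero_pow hp.ne_zero])
  have : NeZero p := ⟨hp.ne_zero⟩
  refine hS.ergodic.hasExactlyErgodicComponents_iterate hp.pos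
    (A := fun i => {x | φ x = ζ ^ i * d}) (fun i => ?_) (fun i => ?_) (fun i => ?_)
    (fun i k h1 h2 => ?_) ?_
  · exact hφm (measurableSet_singleton _)
  · simp only [pow_add, hprim.pow_eq_one, mul_one]
  · filter_upwards [hφS] with x hx
    refine propext ?_
    change φ (S x) = _ ↔ φ x = _
    simp only [Function.comp_apply] at hx
    rw [hx, pow_succ', mul_assoc, mul_right_inj' hζ0]
  · convert measure_empty (μ := ν)
    ext x
    simp only [Set.mem_inter_iff, Set.mem_ofPred_eq, Set.mem_empty_iff_false, iff_false, not_and]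
    intro h h'
    rw [h, mul_left_inj' hd0, pow_add, left_eq_mul₀ (pow_ne_zero _ hζ0)] at h'
    exact hprim.pow_ne_one_of_pos_of_lt h1.ne' h2 h'
  · filter_upwards [hc] with x hx
    have : (φ x / d) ^ p = 1 := by
      rw [div_pow, hd, div_eq_one_iff_eq hc0]
      exact hx
    obtain ⟨i, hi, h⟩ := hprim.eq_pow_of_pow_eq_one this
    exact ⟨i, hi, by rw [h, div_mul_cancel₀ _ hd0]⟩

end Spectrum

/-! ### Existence of rank-one transformations -/

namespace RankOneParams

variable (P : RankOneParams)

theorem h_pos (j : ℕ) : 0 < P.h j := by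
  induction j with
  | zero => exact P.h₀_pos
  | succ j ih => exact Nat.add_pos_left (Nat.mul_pos ih (P.r_pos j)) _

theorem offset_zero (j : ℕ) : P.offset j 0 = 0 := by simp [offset]

theorem offset_succ (j i : ℕ) : P.offset j (i + 1) = P.offset j i + P.h j + P.s j i := by
  simp only [offset, Finset.sum_range_succ]
  ring

theorem offset_r (j : ℕ) : P.offset j (P.r j) = P.h (j + 1) := by
  simp only [offset, h, mul_comm]

theorem offset_strictMono (j : ℕ) : StrictMono (P.offset j) :=
  strictMono_nat_of_lt_succ fun i => by
    rw [offset_succ]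
    have := P.h_pos j
    omega

theorem offset_add_lt {j i k : ℕ} (hi : i < P.r j) (hk : k < P.h j + P.s j i) :
    P.offset j i + k < P.h (j + 1) := by
  have h1 := (P.offset_strictMono j).monotone (Nat.succ_le_of_lt hi)
  rw [Nat.succ_eq_add_one, offset_succ, offset_r] at h1
  omega

/-- Division with remainder by blocks of unequal length. A remainder `k < P.h j` means a piece of
the old floor `k`; a remainder `k ≥ P.h j` means a spacer above column `i`. -/
theorem exists_offset_add_eq {j q : ℕ} (hq : q < P.h (j + 1)) :
    ∃ i < P.r j, ∃ k < P.h j + P.s j i, P.offset j i + k = q := by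
  have hex : ∃ i, q < P.offset j (i + 1) := ⟨P.r j, hq.trans_le (by
    rw [← offset_r]; exact (P.offset_strictMono j).monotone (Nat.le_succ _))⟩
  classical
  set i := Nat.find hex with hi
  have h1 : q < P.offset j (i + 1) := Nat.find_spec hex
  have h2 : P.offset j i ≤ q := by
    rcases Nat.eq_zero_or_pos i with h0 | h0
    · rw [h0, offset_zero]; exact Nat.zero_le _
    · have := Nat.find_min hex (m := i - 1) (by omega)
      rw [Nat.sub_add_cancel h0] at this
      omega
  refine ⟨i, ?_, q - P.offset j i, ?_, by omega⟩
  · rw [← offset_r] at hq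
    exact (P.offset_strictMono j).lt_iff_lt.1 (h2.trans_lt hq)
  · rw [offset_succ] at h1
    omega

theorem offset_add_inj {j i i' k k' : ℕ} (hk : k < P.h j + P.s j i) (hk' : k' < P.h j + P.s j i')
    (h : P.offset j i + k = P.offset j i' + k') : i = i' ∧ k = k' := by
  have aux : ∀ i i' k k', k < P.h j + P.s j i → P.offset j i + k = P.offset j i' + k' →
      i' ≤ i := by
    intro i i' k k' hk h
    by_contra! hlt
    have := (P.offset_strictMono j).monotone (Nat.succ_le_of_lt hlt)
    rw [Nat.succ_eq_add_one, offset_succ] at this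
    omega
  obtain rfl : i = i' := le_antisymm (aux _ _ _ _ hk' h.symm) (aux _ _ _ _ hk h)
  exact ⟨rfl, by omega⟩

/-- The number of the column of tower `j` that contains the `q`-th floor of tower `j + 1`. -/
def column (j q : ℕ) : ℕ := Nat.findGreatest (fun i => P.offset j i ≤ q) (P.r j - 1)

theorem column_offset_add {j i k : ℕ} (hi : i < P.r j) (hk : k < P.h j + P.s j i) :
    P.column j (P.offset j i + k) = i := by
  refine Nat.findGreatest_eq_iff.2 ⟨by omega, fun _ => Nat.le_add_right _ _, fun n hn _ h => ?_⟩
  have := (P.offset_strictMono j).monotone (Nat.succ_le_of_lt hn)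
  rw [Nat.succ_eq_add_one, offset_succ] at this
  omega

/-- The number of the cell, of the grid with mesh `P.width j`, that is the `k`-th floor of
tower `j`. The columns of a floor are ordered from right to left. -/
def cell : ℕ → ℕ → ℕ
  | 0, k => k
  | j + 1, q =>
    if q - P.offset j (P.column j q) < P.h j then
      P.r j * cell j (q - P.offset j (P.column j q)) + (P.r j - 1 - P.column j q)
    -- Spacers lie to the right of all floors of tower `j`; adding the floor number `q` keeps them
    -- apart from each other.
    else P.r j * ((Finset.range (P.h j)).sup (cell j) + 1) + q

theorem cell_succ_of_lt {j i k : ℕ} (hi : i < P.r j) (hk : k < P.h j) :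
    P.cell (j + 1) (P.offset j i + k) = P.r j * P.cell j k + (P.r j - 1 - i) := by
  rw [cell, P.column_offset_add hi (by omega), Nat.add_sub_cancel_left, if_pos hk]

theorem cell_succ_of_le {j i k : ℕ} (hi : i < P.r j) (hk : P.h j ≤ k)
    (hk' : k < P.h j + P.s j i) : P.cell (j + 1) (P.offset j i + k) =
      P.r j * ((Finset.range (P.h j)).sup (P.cell j) + 1) + (P.offset j i + k) := by
  rw [cell, P.column_offset_add hi hk', Nat.add_sub_cancel_left, if_neg (by omega)]

theorem cell_succ_lt {j i k : ℕ} (hi : i < P.r j) (hk : k < P.h j) :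
    P.cell (j + 1) (P.offset j i + k) < P.r j * ((Finset.range (P.h j)).sup (P.cell j) + 1) := by
  rw [P.cell_succ_of_lt hi hk]
  have h1 : P.cell j k ≤ (Finset.range (P.h j)).sup (P.cell j) :=
    Finset.le_sup (f := P.cell j) (Finset.mem_range.2 hk)
  calc _ < P.r j * P.cell j k + P.r j := by omega
    _ = P.r j * (P.cell j k + 1) := by ring
    _ ≤ _ := Nat.mul_le_mul_left _ (by omega)

/-- For pieces of old floors, the residue modulo `P.r j` determines the column and the quotient
determines the old cell; the spacers lie beyond all of these. -/
theorem cell_injOn (j : ℕ) : Set.InjOn (P.cell j) (Set.Iio (P.h j)) := by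
  induction j with
  | zero => exact fun _ _ _ _ h => h
  | succ j ih =>
    intro q hq q' hq' h
    obtain ⟨i, hi, k, hk, rfl⟩ := P.exists_offset_add_eq hq
    obtain ⟨i', hi', k', hk', rfl⟩ := P.exists_offset_add_eq hq'
    rcases lt_or_ge k (P.h j) with h1 | h1 <;> rcases lt_or_ge k' (P.h j) with h2 | h2
    · rw [P.cell_succ_of_lt hi h1, P.cell_succ_of_lt hi' h2] at h
      have hlt : P.r j - 1 - i < P.r j := by omega
      have hlt' : P.r j - 1 - i' < P.r j := by omega
      have e1 : P.r j - 1 - i = P.r j - 1 - i' := by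
        have := congrArg (· % P.r j) h
        simpa [Nat.mul_add_mod, Nat.mod_eq_of_lt hlt, Nat.mod_eq_of_lt hlt'] using this
      have e2 : P.cell j k = P.cell j k' := by
        rw [e1] at h
        exact Nat.eq_of_mul_eq_mul_left (P.r_pos j) (Nat.add_right_cancel h)
      have e3 : k = k' := ih h1 h2 e2
      have e4 : i = i' := by omega
      rw [e3, e4]
    · have := P.cell_succ_lt hi h1
      rw [h, P.cell_succ_of_le hi' h2 hk'] at this
      omega
    · have := P.cell_succ_lt hi' h2
      rw [← h, P.cell_succ_of_le hi h1 hk] at this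
      omega
    · rw [P.cell_succ_of_le hi h1 hk, P.cell_succ_of_le hi' h2 hk'] at h
      omega

/-- The width of tower `j`. -/
def width : ℕ → ℝ
  | 0 => 1
  | j + 1 => width j / P.r j

theorem width_pos (j : ℕ) : 0 < P.width j := by
  induction j with
  | zero => exact one_pos
  | succ j ih => exact div_pos ih (Nat.cast_pos.2 (P.r_pos j))

theorem width_le_one (j : ℕ) : P.width j ≤ 1 := by
  induction j with
  | zero => exact le_rfl
  | succ j ih =>
    have : (1 : ℝ) ≤ P.r j := Nat.one_le_cast.2 (P.r_pos j)
    exact (div_le_self (P.width_pos j).le this).trans ih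

theorem r_mul_width_succ (j : ℕ) : P.r j * P.width (j + 1) = P.width j := by
  have : (P.r j : ℝ) ≠ 0 := Nat.cast_ne_zero.2 (P.r_pos j).ne'
  rw [width]
  field_simp

theorem tendsto_width : Tendsto P.width atTop (𝓝 0) := by
  rw [← tendsto_add_atTop_iff_nat 1]
  have h1 : Tendsto (fun j => (P.r j : ℝ)⁻¹) atTop (𝓝 0) :=
    tendsto_inv_atTop_zero.comp (tendsto_natCast_atTop_atTop.comp P.r_tendsto)
  refine squeeze_zero (fun j => (P.width_pos _).le) (fun j => ?_) h1
  rw [width, div_eq_mul_inv]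
  exact mul_le_of_le_one_left (by positivity) (P.width_le_one j)

/-- The left end of the `k`-th floor of tower `j`. -/
def left (j k : ℕ) : ℝ := P.cell j k * P.width j

/-- The `k`-th floor of tower `j`. -/
def floor (j k : ℕ) : Set ℝ := Set.Ico (P.left j k) (P.left j k + P.width j)

theorem mem_floor {j k : ℕ} {x : ℝ} :
    x ∈ P.floor j k ↔ P.left j k ≤ x ∧ x < P.left j k + P.width j := Iff.rfl

theorem eq_of_mem_floor {j k k' : ℕ} {x : ℝ} (hk : k < P.h j) (hk' : k' < P.h j)
    (hx : x ∈ P.floor j k) (hx' : x ∈ P.floor j k') : k = k' := by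
  refine P.cell_injOn j hk hk' ?_
  have hw := P.width_pos j
  rw [mem_floor, left] at hx hx'
  have aux : ∀ m n : ℕ, m * P.width j ≤ x → x < n * P.width j + P.width j → m ≤ n := by
    intro m n h1 h2
    have : (m : ℝ) < n + 1 := lt_of_mul_lt_mul_right (by linarith) hw.le
    exact Nat.lt_succ_iff.1 (by exact_mod_cast this)
  exact le_antisymm (aux _ _ hx.1 hx'.2) (aux _ _ hx'.1 hx.2)

theorem left_succ {j i k : ℕ} (hi : i < P.r j) (hk : k < P.h j) :
    P.left (j + 1) (P.offset j i + k) =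
      P.left j k + ((P.r j - 1 - i : ℕ) : ℝ) * P.width (j + 1) := by
  rw [left, left, P.cell_succ_of_lt hi hk, Nat.cast_add, Nat.cast_mul, ← P.r_mul_width_succ j]
  ring

theorem floor_succ_subset {j i k : ℕ} (hi : i < P.r j) (hk : k < P.h j) :
    P.floor (j + 1) (P.offset j i + k) ⊆ P.floor j k := by
  intro x hx
  rw [mem_floor, P.left_succ hi hk] at hx
  have hw := P.width_pos (j + 1)
  have h1 : ((P.r j - 1 - i : ℕ) : ℝ) + 1 ≤ P.r j := by
    have : (P.r j - 1 - i) + 1 ≤ P.r j := by omega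
    exact_mod_cast this
  have h2 := mul_le_mul_of_nonneg_right h1 hw.le
  rw [r_mul_width_succ] at h2
  have h3 : 0 ≤ ((P.r j - 1 - i : ℕ) : ℝ) * P.width (j + 1) := by positivity
  exact ⟨by linarith, by linarith⟩

theorem exists_mem_floor_succ {j k : ℕ} (hk : k < P.h j) {x : ℝ} (hx : x ∈ P.floor j k) :
    ∃ i < P.r j, x ∈ P.floor (j + 1) (P.offset j i + k) := by
  have hw := P.width_pos (j + 1)
  rw [mem_floor] at hx
  set n := ⌊(x - P.left j k) / P.width (j + 1)⌋₊ with hn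
  have h0 : 0 ≤ (x - P.left j k) / P.width (j + 1) := div_nonneg (by linarith) hw.le
  have h1 : n * P.width (j + 1) ≤ x - P.left j k := by
    rw [← le_div_iff₀ hw]; exact Nat.floor_le h0
  have h2 : x - P.left j k < (n + 1) * P.width (j + 1) := by
    rw [← div_lt_iff₀ hw]; exact Nat.lt_floor_add_one _
  have hnr : n < P.r j := by
    have : (n : ℝ) < P.r j := by
      refine lt_of_mul_lt_mul_right ?_ hw.le
      rw [r_mul_width_succ]; linarith
    exact_mod_cast this
  refine ⟨P.r j - 1 - n, by omega, ?_⟩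
  have hi : P.r j - 1 - (P.r j - 1 - n) = n := by omega
  rw [mem_floor, P.left_succ (by omega) hk, hi]
  exact ⟨by linarith, by linarith⟩

theorem floor_eq_iUnion {j k : ℕ} (hk : k < P.h j) :
    P.floor j k = ⋃ i ∈ Set.Iio (P.r j), P.floor (j + 1) (P.offset j i + k) := by
  ext x
  simp only [Set.mem_iUnion, Set.mem_Iio, exists_prop]
  exact ⟨P.exists_mem_floor_succ hk, fun ⟨i, hi, hx⟩ => P.floor_succ_subset hi hk hx⟩

/-- This is the purpose of ordering columns from right to left: the bases `[1 - w_j, 1)` shrink to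
the point `1`, which none of them contains. In the opposite order the left end of the first base
would lie in all bases and have no preimage under `T`. -/
theorem left_zero_add_width (j : ℕ) : P.left j 0 + P.width j = 1 := by
  induction j with
  | zero => simp [left, cell, width]
  | succ j ih =>
    have h := P.left_succ (P.r_pos j) (P.h_pos j)
    rw [offset_zero, add_zero] at h
    rw [h, ← ih, ← P.r_mul_width_succ j, Nat.sub_zero, Nat.cast_sub (P.r_pos j)]
    push_cast
    ring

/-- The union of all towers. -/
def space : Set ℝ := ⋃ j, ⋃ k ∈ Set.Iio (P.h j), P.floor j k

theorem mem_space {x : ℝ} : x ∈ P.space ↔ ∃ j, ∃ k < P.h j, x ∈ P.floor j k := by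
  simp [space]

theorem exists_mem_floor_of_le {j j' k : ℕ} (hj : j ≤ j') (hk : k < P.h j) {x : ℝ}
    (hx : x ∈ P.floor j k) : ∃ k' < P.h j', x ∈ P.floor j' k' := by
  induction j', hj using Nat.le_induction with
  | base => exact ⟨k, hk, hx⟩
  | succ j' _ ih =>
    obtain ⟨k', hk', hx'⟩ := ih
    obtain ⟨i, hi, h⟩ := P.exists_mem_floor_succ hk' hx'
    exact ⟨_, P.offset_add_lt hi (by omega), h⟩

/-- `y` lies directly above `x` in tower `j`. -/
def Step (j : ℕ) (x y : ℝ) : Prop :=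
  ∃ k, k + 1 < P.h j ∧ x ∈ P.floor j k ∧ y = x + (P.left j (k + 1) - P.left j k)

variable {P}

theorem mem_floor_add_sub {j k l : ℕ} {x : ℝ} (hx : x ∈ P.floor j k) :
    x + (P.left j l - P.left j k) ∈ P.floor j l := by
  rw [mem_floor] at hx ⊢
  constructor <;> linarith [hx.1, hx.2]

/-- Neighbouring floors are cut in the same way, so inside a column the translation vector to the
floor above does not change. The partial maps of the successive towers therefore extend one another.
-/
theorem Step.succ {j : ℕ} {x y : ℝ} (h : P.Step j x y) : P.Step (j + 1) x y := by
  obtain ⟨k, hk, hx, rfl⟩ := h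
  obtain ⟨i, hi, hx'⟩ := P.exists_mem_floor_succ (by omega) hx
  refine ⟨P.offset j i + k, ?_, hx', ?_⟩
  · rw [add_assoc]; exact P.offset_add_lt hi (by omega)
  · rw [add_assoc, P.left_succ hi hk, P.left_succ hi (by omega)]
    ring

theorem Step.of_le {j j' : ℕ} (hj : j ≤ j') {x y : ℝ} (h : P.Step j x y) : P.Step j' x y := by
  induction j', hj using Nat.le_induction with
  | base => exact h
  | succ j' _ ih => exact ih.succ

theorem Step.right_unique {j j' : ℕ} {x y y' : ℝ} (h : P.Step j x y) (h' : P.Step j' x y') :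
    y = y' := by
  obtain ⟨k, hk, hx, rfl⟩ := h.of_le (le_max_left j j')
  obtain ⟨k', hk', hx', rfl⟩ := h'.of_le (le_max_right j j')
  rw [P.eq_of_mem_floor (by omega) (by omega) hx hx']

theorem Step.left_unique {j j' : ℕ} {x x' y : ℝ} (h : P.Step j x y) (h' : P.Step j' x' y) :
    x = x' := by
  obtain ⟨k, hk, hx, rfl⟩ := h.of_le (le_max_left j j')
  obtain ⟨k', hk', hx', he⟩ := h'.of_le (le_max_right j j')
  have h1 := mem_floor_add_sub (l := k + 1) hx
  have h2 := mem_floor_add_sub (l := k' + 1) hx'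
  rw [← he] at h2
  have := P.eq_of_mem_floor hk hk' h1 h2
  obtain rfl : k = k' := by omega
  linarith

theorem Step.mem_space_left {j : ℕ} {x y : ℝ} (h : P.Step j x y) : x ∈ P.space := by
  obtain ⟨k, hk, hx, rfl⟩ := h
  exact P.mem_space.2 ⟨j, k, by omega, hx⟩

theorem Step.mem_space_right {j : ℕ} {x y : ℝ} (h : P.Step j x y) : y ∈ P.space := by
  obtain ⟨k, hk, hx, rfl⟩ := h
  exact P.mem_space.2 ⟨j, k + 1, hk, mem_floor_add_sub hx⟩

/-- A point cannot stay in the bases `[1 - w_j, 1)` forever, because `w_j → 0`. As soon as it is on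
a higher floor, the floor below contains its preimage. -/
theorem exists_step_left {y : ℝ} (hy : y ∈ P.space) : ∃ x j, P.Step j x y := by
  obtain ⟨j, k, hk, hyk⟩ := P.mem_space.1 hy
  have hall : ∃ j' ≥ j, y ∉ P.floor j' 0 := by
    by_contra! hcon
    have h1 : ∀ᶠ j' in atTop, 1 - y ≤ P.width j' := by
      filter_upwards [eventually_ge_atTop j] with j' hj'
      have := (P.mem_floor.1 (hcon j' hj')).1
      have := P.left_zero_add_width j'
      linarith
    have h2 := ge_of_tendsto P.tendsto_width h1
    have h3 := (P.mem_floor.1 (hcon j le_rfl)).2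
    rw [left_zero_add_width] at h3
    linarith
  obtain ⟨j', hj', h0⟩ := hall
  obtain ⟨k', hk', hyk'⟩ := P.exists_mem_floor_of_le hj' hk hyk
  have hk0 : 0 < k' := Nat.pos_of_ne_zero fun h => h0 (h ▸ hyk')
  refine ⟨y + (P.left j' (k' - 1) - P.left j' k'), j', k' - 1, by omega, mem_floor_add_sub hyk', ?_⟩
  rw [Nat.sub_add_cancel hk0]
  ring

/-- Only a point in the last column can remain on top, and infinitely often this column receives a
spacer. So `T` is defined at every point, with no exceptional null set. -/
theorem exists_step_right (hP : ∃ᶠ j in atTop, 0 < P.s j (P.r j - 1)) {x : ℝ}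
    (hx : x ∈ P.space) : ∃ y j, P.Step j x y := by
  obtain ⟨j, k, hk, hxk⟩ := P.mem_space.1 hx
  obtain ⟨j', hj', hs⟩ := frequently_atTop.1 hP j
  obtain ⟨k', hk', hxk'⟩ := P.exists_mem_floor_of_le hj' hk hxk
  obtain ⟨i, hi, hxi⟩ := P.exists_mem_floor_succ hk' hxk'
  refine ⟨_, j' + 1, P.offset j' i + k', ?_, hxi, rfl⟩
  rcases Nat.lt_or_ge (i + 1) (P.r j') with h | h
  · have h1 := (P.offset_strictMono j').lt_iff_lt.2 h
    rw [offset_succ, offset_r] at h1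
    omega
  · have : i = P.r j' - 1 := by omega
    rw [add_assoc]
    exact P.offset_add_lt hi (by rw [this]; omega)

end RankOneParams

/-! ### The transformation as a measure preserving automorphism -/

theorem measurable_of_eqOn_iUnion {α β ι : Type*} [MeasurableSpace α] [MeasurableSpace β]
    [Countable ι] {f : α → β} {s : ι → Set α} {g : ι → α → β} (hs : ∀ i, MeasurableSet (s i))
    (hU : ∀ x, ∃ i, x ∈ s i) (hg : ∀ i, Measurable (g i)) (hfg : ∀ i, Set.EqOn f (g i) (s i)) :
    Measurable f := by
  intro B hB
  have : f ⁻¹' B = ⋃ i, s i ∩ g i ⁻¹' B := by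
    ext x
    simp only [Set.mem_preimage, Set.mem_iUnion, Set.mem_inter_iff]
    refine ⟨fun hx => ?_, fun ⟨i, hi, hx⟩ => hfg i hi ▸ hx⟩
    obtain ⟨i, hi⟩ := hU x
    exact ⟨i, hi, hfg i hi ▸ hx⟩
  rw [this]
  exact MeasurableSet.iUnion fun i => (hs i).inter (hg i hB)

theorem measurePreserving_of_iUnion {α ι : Type*} [MeasurableSpace α] {μ : Measure α} [Countable ι]
    {f : α → α} {s : ι → Set α} (hf : Measurable f) (hs : ∀ i, MeasurableSet (s i))
    (hU : ∀ x, ∃ i, x ∈ s i)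
    (h : ∀ i B, MeasurableSet B → B ⊆ s i → μ (f ⁻¹' B) = μ B) : MeasurePreserving f μ μ := by
  refine ⟨hf, (Measure.ext_iff_of_iUnion_eq_univ (s := s) ?_).2 fun i => Measure.ext fun B hB => ?_⟩
  · exact Set.eq_univ_of_forall fun x => Set.mem_iUnion.2 (hU x)
  · rw [Measure.restrict_apply hB, Measure.restrict_apply hB, Measure.map_apply hf (hB.inter (hs i)),
      h i _ (hB.inter (hs i)) Set.inter_subset_right]

namespace RankOneParams

variable (P : RankOneParams)

theorem measurableSet_floor (j k : ℕ) : MeasurableSet (P.floor j k) := measurableSet_Ico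

theorem measurableSet_space : MeasurableSet P.space :=
  MeasurableSet.iUnion fun j => MeasurableSet.biUnion (Set.to_countable _) fun k _ =>
    P.measurableSet_floor j k

theorem lebesgueOn_apply (A : Set P.space) :
    lebesgueOn P.space A = volume (Subtype.val '' A) :=
  (MeasurableEmbedding.subtype_coe P.measurableSet_space).comap_apply _ _

/-- The `k`-th floor of tower `j`, as a set in the union of all towers. -/
def level (j k : ℕ) : Set P.space := Subtype.val ⁻¹' P.floor j k

theorem measurableSet_level (j k : ℕ) : MeasurableSet (P.level j k) :=
  measurable_subtype_coe (P.measurableSet_floor j k)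

variable {P} (hP : ∃ᶠ j in atTop, 0 < P.s j (P.r j - 1))

/-- The image of a point under the rank-one transformation with parameters `P`. -/
def next (x : P.space) : P.space :=
  ⟨(exists_step_right hP x.2).choose,
    (exists_step_right hP x.2).choose_spec.choose_spec.mem_space_right⟩

theorem exists_step_next (x : P.space) : ∃ j, P.Step j x (next hP x) :=
  (exists_step_right hP x.2).choose_spec

theorem next_bijective : Function.Bijective (next hP) := by
  constructor
  · intro x x' h
    obtain ⟨j, hj⟩ := exists_step_next hP x
    obtain ⟨j', hj'⟩ := exists_step_next hP x'
    rw [h] at hj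
    exact Subtype.ext (hj.left_unique hj')
  · intro y
    obtain ⟨x, j, hj⟩ := exists_step_left y.2
    obtain ⟨j', hj'⟩ := exists_step_next hP ⟨x, hj.mem_space_left⟩
    exact ⟨⟨x, hj.mem_space_left⟩, Subtype.ext (hj'.right_unique hj)⟩

/-- The rank-one transformation with parameters `P`, on the union of all towers. -/
def transformationEquiv : P.space ≃ P.space := Equiv.ofBijective (next hP) (next_bijective hP)

theorem exists_step_transformationEquiv (x : P.space) :
    ∃ j, P.Step j x (transformationEquiv hP x) :=
  exists_step_next hP x

/-- The floors that are not at the top of their tower. -/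
abbrev LowerFloor (P : RankOneParams) : Type := {n : ℕ × ℕ // n.2 + 1 < P.h n.1}

theorem exists_lowerFloor_mem (hP : ∃ᶠ j in atTop, 0 < P.s j (P.r j - 1)) (x : P.space) :
    ∃ n : LowerFloor P, x ∈ P.level n.1.1 n.1.2 := by
  obtain ⟨j, k, hk, hx, -⟩ := exists_step_transformationEquiv hP x
  exact ⟨⟨(j, k), hk⟩, hx⟩

theorem exists_lowerFloor_mem_succ (y : P.space) :
    ∃ n : LowerFloor P, y ∈ P.level n.1.1 (n.1.2 + 1) := by
  obtain ⟨x, j, k, hk, hx, he⟩ := exists_step_left y.2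
  refine ⟨⟨(j, k), hk⟩, ?_⟩
  change (y : ℝ) ∈ P.floor j (k + 1)
  rw [he]
  exact mem_floor_add_sub hx

theorem coe_transformationEquiv {j k : ℕ} (hk : k + 1 < P.h j) {x : P.space}
    (hx : x ∈ P.level j k) :
    (transformationEquiv hP x : ℝ) = x + (P.left j (k + 1) - P.left j k) := by
  have h : P.Step j x (x + (P.left j (k + 1) - P.left j k)) := ⟨k, hk, hx, rfl⟩
  obtain ⟨j', h'⟩ := exists_step_transformationEquiv hP x
  exact h'.right_unique h

theorem coe_transformationEquiv_symm {j k : ℕ} (hk : k + 1 < P.h j) {y : P.space}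
    (hy : y ∈ P.level j (k + 1)) :
    ((transformationEquiv hP).symm y : ℝ) = y + (P.left j k - P.left j (k + 1)) := by
  have h : P.Step j (y + (P.left j k - P.left j (k + 1))) y :=
    ⟨k, hk, mem_floor_add_sub hy, by ring⟩
  obtain ⟨j', h'⟩ := exists_step_transformationEquiv hP ((transformationEquiv hP).symm y)
  rw [Equiv.apply_symm_apply] at h'
  exact h'.left_unique h

/-- The rank-one transformation with parameters `P`, as a measurable equivalence. -/
def transformation : P.space ≃ᵐ P.space where
  toEquiv := transformationEquiv hP
  measurable_toFun := by
    have he := MeasurableEmbedding.subtype_coe P.measurableSet_space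
    refine he.measurable_comp_iff.1 ?_
    exact measurable_of_eqOn_iUnion (s := fun n : LowerFloor P => P.level n.1.1 n.1.2)
      (fun n => P.measurableSet_level _ _) (exists_lowerFloor_mem hP)
      (fun n => measurable_subtype_coe.add_const _)
      (fun n x hx => coe_transformationEquiv hP n.2 hx)
  measurable_invFun := by
    have he := MeasurableEmbedding.subtype_coe P.measurableSet_space
    refine he.measurable_comp_iff.1 ?_
    exact measurable_of_eqOn_iUnion (s := fun n : LowerFloor P => P.level n.1.1 (n.1.2 + 1))
      (fun n => P.measurableSet_level _ _) (exists_lowerFloor_mem_succ (P := P))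
      (fun n => measurable_subtype_coe.add_const _)
      (fun n x hx => coe_transformationEquiv_symm hP n.2 hx)

theorem coe_transformation {j k : ℕ} (hk : k + 1 < P.h j) {x : P.space} (hx : x ∈ P.level j k) :
    (transformation hP x : ℝ) = x + (P.left j (k + 1) - P.left j k) :=
  coe_transformationEquiv hP hk hx

theorem coe_transformation_symm {j k : ℕ} (hk : k + 1 < P.h j) {y : P.space}
    (hy : y ∈ P.level j (k + 1)) :
    ((transformation hP).symm y : ℝ) = y + (P.left j k - P.left j (k + 1)) :=
  coe_transformationEquiv_symm hP hk hy

/-- The floors other than the bases cover the space, and on each of them the inverse is a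
translation. -/
theorem measurePreserving_transformation :
    MeasurePreserving (transformation hP) (lebesgueOn P.space) (lebesgueOn P.space) := by
  refine measurePreserving_of_iUnion (s := fun n : LowerFloor P => P.level n.1.1 (n.1.2 + 1))
    (transformation hP).measurable (fun n => P.measurableSet_level _ _)
    (exists_lowerFloor_mem_succ (P := P)) ?_
  rintro ⟨⟨j, k⟩, hk⟩ B hB hBs
  rw [lebesgueOn_apply, lebesgueOn_apply]
  have : Subtype.val '' (transformation hP ⁻¹' B) =
      (fun x : ℝ => x + (P.left j (k + 1) - P.left j k)) ⁻¹' (Subtype.val '' B) := by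
    ext x
    constructor
    · rintro ⟨x, hx, rfl⟩
      refine ⟨transformation hP x, hx, ?_⟩
      have := coe_transformation_symm hP hk (hBs hx)
      rw [MeasurableEquiv.symm_apply_apply] at this
      linarith
    · rintro ⟨y, hy, hyx⟩
      have h := coe_transformation_symm hP hk (hBs hy)
      refine ⟨(transformation hP).symm y, ?_, ?_⟩
      · rwa [Set.mem_preimage, MeasurableEquiv.apply_symm_apply]
      · rw [h, hyx]; ring
  rw [this, measure_preimage_add_right]

theorem isRankOneConstruction_transformation :
    IsRankOneConstruction P P.space (transformation hP) P.left P.width where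
  width_pos := P.width_pos
  width_succ _ := rfl
  disjoint _ _ hk _ hk' hkk := Set.disjoint_left.2 fun _ hx hx' =>
    hkk (P.eq_of_mem_floor hk hk' hx hx')
  cut j := (P.floor_eq_iUnion (P.h_pos j)).symm
  translation _ _ hk _ hx := coe_transformation hP hk hx
  union := rfl

theorem iterate_mem_level {j k n : ℕ} (hk : k + n < P.h j) {x : P.space} (hx : x ∈ P.level j k) :
    (transformation hP)^[n] x ∈ P.level j (k + n) := by
  induction n with
  | zero => exact hx
  | succ n ih =>
    rw [Function.iterate_succ_apply']
    change ((transformation hP _ : P.space) : ℝ) ∈ P.floor j (k + n + 1)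
    rw [coe_transformation hP hk (ih (by omega))]
    exact mem_floor_add_sub (ih (by omega))

theorem iterate_preimage_level {j k n : ℕ} (hk : k + n < P.h j) :
    (transformation hP)^[n] ⁻¹' P.level j (k + n) = P.level j k := by
  refine subset_antisymm (fun x hx => ?_) fun x hx => iterate_mem_level hP hk hx
  induction n with
  | zero => exact hx
  | succ n ih =>
    refine ih (by omega) ?_
    rw [Set.mem_preimage, Function.iterate_succ_apply'] at hx
    have h := coe_transformation_symm hP (k := k + n) hk hx
    rw [MeasurableEquiv.symm_apply_apply] at h
    change (((transformation hP)^[n] x : P.space) : ℝ) ∈ P.floor j (k + n)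
    rw [h]
    exact mem_floor_add_sub hx

variable (P)

instance sigmaFinite_lebesgueOn_space : SigmaFinite (lebesgueOn P.space) :=
  SigmaFinite.of_map (lebesgueOn P.space) measurable_subtype_coe.aemeasurable (by
    rw [lebesgueOn, (MeasurableEmbedding.subtype_coe P.measurableSet_space).map_comap]
    infer_instance)

theorem lebesgueOn_level {j k : ℕ} (hk : k < P.h j) :
    lebesgueOn P.space (P.level j k) = ENNReal.ofReal (P.width j) := by
  rw [lebesgueOn_apply, level, Subtype.image_preimage_coe, Set.inter_eq_self_of_subset_right,
    floor, Real.volume_Ico, add_sub_cancel_left]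
  exact fun x hx => P.mem_space.2 ⟨j, k, hk, hx⟩

theorem disjoint_level {j k k' : ℕ} (hk : k < P.h j) (hk' : k' < P.h j) (h : k ≠ k') :
    Disjoint (P.level j k) (P.level j k') :=
  Set.disjoint_left.2 fun _ hx hx' => h (P.eq_of_mem_floor hk hk' hx hx')

theorem lebesgueOn_biUnion_level {j : ℕ} (Q : Finset ℕ) (hQ : ∀ k ∈ Q, k < P.h j) :
    lebesgueOn P.space (⋃ k ∈ Q, P.level j k) = Q.card * ENNReal.ofReal (P.width j) := by
  rw [measure_biUnion_finset _ fun k _ => P.measurableSet_level j k,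
    Finset.sum_congr rfl fun k hk => P.lebesgueOn_level (hQ k hk), Finset.sum_const, nsmul_eq_mul]
  exact fun k hk k' hk' h => P.disjoint_level (hQ k hk) (hQ k' hk') h

theorem lebesgueOn_space_univ (h : ∀ M : ℕ, ∃ j, (M : ℝ) ≤ P.h j * P.width j) :
    lebesgueOn P.space Set.univ = ⊤ := by
  refine ENNReal.eq_top_of_forall_nnreal_le fun M => ?_
  obtain ⟨n, hn⟩ := exists_nat_ge (M : ℝ)
  obtain ⟨j, hj⟩ := h n
  calc (M : ENNReal) = ENNReal.ofReal M := by simp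
    _ ≤ ENNReal.ofReal (P.h j * P.width j) := ENNReal.ofReal_le_ofReal (hn.trans hj)
    _ = lebesgueOn P.space (⋃ k ∈ Finset.range (P.h j), P.level j k) := by
      rw [P.lebesgueOn_biUnion_level _ fun k hk => Finset.mem_range.1 hk, Finset.card_range,
        ENNReal.ofReal_mul (by positivity), ENNReal.ofReal_natCast]
    _ ≤ _ := measure_mono (Set.subset_univ _)

end RankOneParams

namespace RankOneParams

/-! ### Approximation by floors -/

variable {P : RankOneParams}

theorem exists_seq_mem_floor {x : ℝ} (hx : x ∈ P.space) :
    ∃ k : ℕ → ℕ, ∀ᶠ j in atTop, k j < P.h j ∧ x ∈ P.floor j (k j) := by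
  obtain ⟨j₀, k₀, hk₀, hx₀⟩ := P.mem_space.1 hx
  have : ∀ j, ∃ k, j₀ ≤ j → k < P.h j ∧ x ∈ P.floor j k := fun j => by
    by_cases hj : j₀ ≤ j
    · obtain ⟨k, hk, h⟩ := P.exists_mem_floor_of_le hj hk₀ hx₀
      exact ⟨k, fun _ => ⟨hk, h⟩⟩
    · exact ⟨0, fun h => absurd h hj⟩
  choose k hk using this
  exact ⟨k, eventually_atTop.2 ⟨j₀, hk⟩⟩

-- Floors are closed balls up to an endpoint. The density and differentiation theorems for doubling
-- measures allow balls that contain the point without being centred at it, so they apply to the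
-- floors around a point.
variable (P) in
theorem closedBall_ae_eq_floor (j k : ℕ) :
    Metric.closedBall (P.left j k + P.width j / 2) (P.width j / 2) =ᵐ[volume] P.floor j k := by
  rw [Real.closedBall_eq_Icc, add_sub_cancel_right, add_assoc, add_halves]
  exact Ico_ae_eq_Icc.symm

variable (P) in
theorem tendsto_half_width : Tendsto (fun j => P.width j / 2) atTop (𝓝[>] 0) := by
  refine tendsto_nhdsWithin_iff.2 ⟨?_, Eventually.of_forall fun j => half_pos (P.width_pos j)⟩
  simpa using P.tendsto_width.div_const 2

theorem mem_closedBall_of_mem_floor {j k : ℕ} {x : ℝ} (hx : x ∈ P.floor j k) :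
    x ∈ Metric.closedBall (P.left j k + P.width j / 2) (1 * (P.width j / 2)) := by
  rw [one_mul, Real.closedBall_eq_Icc, add_sub_cancel_right, add_assoc, add_halves]
  exact Set.Ico_subset_Icc_self hx

variable (P) in
theorem measure_level_ne_top {j k : ℕ} (hk : k < P.h j) :
    lebesgueOn P.space (P.level j k) ≠ ⊤ := by
  rw [P.lebesgueOn_level hk]; exact ENNReal.ofReal_ne_top

/-- A set whose density in all floors of infinitely many towers is bounded away from `1` is
a null set. -/
theorem lebesgueOn_eq_zero_of_frequently_le {A : Set P.space} (hA : MeasurableSet A) {c : ℝ}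
    (hc : c < 1) (h : ∃ᶠ j in atTop, ∀ k < P.h j,
      (lebesgueOn P.space).real (A ∩ P.level j k) ≤ c * P.width j) :
    lebesgueOn P.space A = 0 := by
  have he := MeasurableEmbedding.subtype_coe P.measurableSet_space
  have hA' : MeasurableSet (Subtype.val '' A) := he.measurableSet_image.2 hA
  have hae := IsUnifLocDoublingMeasure.ae_tendsto_measure_inter_div volume (Subtype.val '' A) 1
  rw [lebesgueOn_apply, ← Measure.restrict_eq_zero, ← ae_eq_bot, ← eventually_false_iff_eq_bot]
  filter_upwards [hae, ae_restrict_mem hA'] with x hx hxA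
  have hxs : x ∈ P.space := by
    obtain ⟨y, -, rfl⟩ := hxA
    exact y.2
  obtain ⟨k, hk⟩ := exists_seq_mem_floor hxs
  have hlim := hx (fun j => P.left j (k j) + P.width j / 2) (fun j => P.width j / 2)
    P.tendsto_half_width (hk.mono fun j hj => mem_closedBall_of_mem_floor hj.2)
  have hfreq := (h.and_eventually hk).mono fun j hj => (show
      volume (Subtype.val '' A ∩ Metric.closedBall (P.left j (k j) + P.width j / 2)
        (P.width j / 2)) / volume (Metric.closedBall (P.left j (k j) + P.width j / 2)
        (P.width j / 2)) ≤ ENNReal.ofReal c from by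
    obtain ⟨hj, hkj, -⟩ := hj
    have hb := P.closedBall_ae_eq_floor j (k j)
    have hw := P.width_pos j
    rw [measure_congr hb, measure_congr ((ae_eq_refl _).inter hb), floor, Real.volume_Ico,
      add_sub_cancel_left]
    refine ENNReal.div_le_of_le_mul ?_
    have h1 := ENNReal.ofReal_le_ofReal (hj _ hkj)
    rw [ofReal_measureReal (measure_ne_top_of_subset Set.inter_subset_right
      (P.measure_level_ne_top hkj)), ENNReal.ofReal_mul' hw.le, lebesgueOn_apply, level,
      Set.image_inter_preimage] at h1
    exact h1)
  -- At a density point the densities in the surrounding floors tend to `1`, yet they are at most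
  -- `c` infinitely often.
  have h1 := le_of_tendsto_of_frequently hlim hfreq
  rw [ENNReal.one_le_ofReal] at h1
  linarith

/-- Lebesgue differentiation: almost every value is the limit of averages over shrinking floors.
This gives the density of the span of the floor indicators. -/
theorem eq_zero_of_forall_setIntegral_level_eq_zero (g : Lp ℝ 2 (lebesgueOn P.space))
    (hg : ∀ j, ∀ k < P.h j, ∫ x in P.level j k, g x ∂lebesgueOn P.space = 0) : g = 0 := by
  have he := MeasurableEmbedding.subtype_coe P.measurableSet_space
  have hmap : (lebesgueOn P.space).map Subtype.val = volume.restrict P.space := by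
    rw [lebesgueOn, he.map_comap, Subtype.range_coe]
  set f : ℝ → ℝ := Function.extend Subtype.val g 0 with hf
  have hfg : ∀ x : P.space, f x = g x := fun x => Subtype.val_injective.extend_apply _ _ x
  have hfmem : MemLp f 2 (volume.restrict P.space) := by
    rw [← hmap, he.memLp_map_measure_iff]
    exact (Lp.memLp g).congr_norm ((Lp.aestronglyMeasurable g).congr
      (ae_of_all _ fun x => (hfg x).symm)) (ae_of_all _ fun x => by simp [hfg])
  have hfi : P.space.indicator f = f := by
    refine Set.indicator_eq_self.2 fun x hx => ?_
    by_contra hxs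
    refine hx (Function.extend_apply' _ _ _ ?_)
    rintro ⟨y, rfl⟩
    exact hxs y.2
  have hloc : LocallyIntegrable f volume := by
    rw [← hfi]
    exact ((memLp_indicator_iff_restrict P.measurableSet_space).2 hfmem).locallyIntegrable
      one_le_two
  have hint : ∀ j, ∀ k < P.h j, ∫ x in P.floor j k, f x = 0 := by
    intro j k hk
    have h1 : P.floor j k ⊆ P.space := fun x hx => P.mem_space.2 ⟨j, k, hk, hx⟩
    rw [← Set.inter_eq_self_of_subset_left h1,
      ← Measure.restrict_restrict (P.measurableSet_floor j k), ← hmap, he.setIntegral_map, ← hg j k hk]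
    exact integral_congr_ae (ae_of_all _ hfg)
  have hae : ∀ᵐ x : ℝ, x ∈ P.space → f x = 0 := by
    filter_upwards [IsUnifLocDoublingMeasure.ae_tendsto_average volume hloc 1] with x hx hxs
    obtain ⟨k, hk⟩ := exists_seq_mem_floor hxs
    have hlim := hx (fun j => P.left j (k j) + P.width j / 2) (fun j => P.width j / 2)
      P.tendsto_half_width (hk.mono fun j hj => mem_closedBall_of_mem_floor hj.2)
    refine tendsto_nhds_unique hlim (tendsto_const_nhds.congr' ?_)
    filter_upwards [hk] with j hj
    rw [setAverage_eq, setIntegral_congr_set (P.closedBall_ae_eq_floor j (k j)), hint j _ hj.1,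
      smul_zero]
  rw [Lp.eq_zero_iff_ae_eq_zero]
  rw [← ae_restrict_iff' P.measurableSet_space, ← hmap, he.ae_map_iff] at hae
  filter_upwards [hae] with x hx
  rw [← hfg, hx]
  rfl

/-! ### Ergodicity of powers -/

variable (hP : ∃ᶠ j in atTop, 0 < P.s j (P.r j - 1))

/-- If `q' = q + N m`, then `T^{N m}` carries floor `q` onto floor `q'` and preserves both `E` and
the measure. -/
theorem lebesgueOn_inter_level_of_modEq {N : ℕ} {E : Set P.space} (hE : MeasurableSet E)
    (hinv : (transformation hP)^[N] ⁻¹' E = E) {j q q' : ℕ} (hq : q < P.h j) (hq' : q' < P.h j)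
    (h : q ≡ q' [MOD N]) :
    lebesgueOn P.space (E ∩ P.level j q) = lebesgueOn P.space (E ∩ P.level j q') := by
  wlog hle : q ≤ q' generalizing q q'
  · exact (this hq' hq h.symm (by omega)).symm
  obtain ⟨m, hm⟩ := (Nat.modEq_iff_dvd' hle).1 h
  obtain rfl : q' = q + N * m := by omega
  have hinvm : (transformation hP)^[N * m] ⁻¹' E = E := by
    rw [Function.iterate_mul]
    clear hm hq' h hle
    induction m with
    | zero => rfl
    | succ m ih => rw [Function.iterate_succ', Set.preimage_comp, hinv, ih]
  rw [← ((measurePreserving_transformation hP).iterate (N * m)).measure_preimage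
    (hE.inter (P.measurableSet_level j (q + N * m))).nullMeasurableSet, Set.preimage_inter, hinvm,
    iterate_preimage_level hP hq']

theorem level_succ_subset {j i k : ℕ} (hi : i < P.r j) (hk : k < P.h j) :
    P.level (j + 1) (P.offset j i + k) ⊆ P.level j k :=
  Set.preimage_mono (P.floor_succ_subset hi hk)

/-- Either the complement of `E` has density at most `1/2` in all floors of infinitely many towers,
and is null; or every late tower has a floor mostly in the complement. At a stage with
equidistributed offsets, this one floor of tower `j + 1` forces density at least `1 / (2N)` of the
complement in every floor of tower `j`, so that `E` is null. -/
theorem ergodic_iterate_transformation {N : ℕ} (hN : 0 < N)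
    (hfreq : ∃ᶠ j in atTop, N ∣ P.r j ∧ ∀ i < P.r j, P.offset j i ≡ i [MOD N]) :
    Ergodic (transformation hP)^[N] (lebesgueOn P.space) := by
  refine ⟨(measurePreserving_transformation hP).iterate N, ⟨fun E hE hinv => ?_⟩⟩
  set μ := lebesgueOn P.space with hμ
  have hinv' : (transformation hP)^[N] ⁻¹' Eᶜ = Eᶜ := by rw [Set.preimage_compl, hinv]
  rw [eventuallyConst_set]
  by_cases hcase : ∃ᶠ j in atTop, ∀ q < P.h j, μ.real (Eᶜ ∩ P.level j q) ≤ 1 / 2 * P.width j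
  · left
    exact lebesgueOn_eq_zero_of_frequently_le hE.compl (by norm_num) hcase
  right
  refine measure_eq_zero_iff_ae_notMem.1 ?_
  have hNR : (0 : ℝ) < N := Nat.cast_pos.2 hN
  refine lebesgueOn_eq_zero_of_frequently_le hE (c := 1 - 1 / (2 * N))
    (by simp; positivity) ?_
  rw [not_frequently] at hcase
  refine (hfreq.and_eventually ((tendsto_add_atTop_nat 1).eventually hcase)).mono ?_
  -- The floor `q` is taken in tower `j + 1`, whereas the density estimate concerns the floors `k`
  -- of tower `j`.
  rintro j ⟨⟨⟨t, ht⟩, hoff⟩, hq⟩ k hk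
  push Not at hq
  obtain ⟨q, hq, hqE⟩ := hq
  -- `v` is `q - k` modulo `N`, written without subtraction. The columns `i ≡ v` are those whose
  -- piece of floor `k` is congruent to `q`; they are one `N`-th of all columns.
  set v := q + (N - 1) * k with hv
  set I := (Finset.range (P.r j)).filter (· ≡ v [MOD N]) with hI
  have hcard : I.card = t := by
    rw [hI, ← Nat.count_eq_card_filter_range, Nat.count_modEq_card _ hN, ht]
    simp [hN]
  have hmod : ∀ i ∈ I, P.offset j i + k ≡ q [MOD N] := by
    intro i hi
    obtain ⟨hir, hiv⟩ := Finset.mem_filter.1 hi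
    have h1 : P.offset j i + k ≡ v + k [MOD N] :=
      ((hoff i (Finset.mem_range.1 hir)).trans hiv).add_right k
    have h2 : v + k = q + N * k := by
      obtain ⟨n, rfl⟩ := Nat.exists_eq_add_of_le' hN
      rw [hv, Nat.add_sub_cancel]; ring
    rw [h2] at h1
    exact h1.trans (by simp [Nat.ModEq])
  have hlt : ∀ i ∈ I, P.offset j i + k < P.h (j + 1) := fun i hi =>
    P.offset_add_lt (Finset.mem_range.1 (Finset.mem_filter.1 hi).1) (by omega)
  have hfin : μ (Eᶜ ∩ P.level j k) ≠ ⊤ :=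
    measure_ne_top_of_subset Set.inter_subset_right (P.measure_level_ne_top hk)
  have hge : t * (1 / 2 * P.width (j + 1)) ≤ μ.real (Eᶜ ∩ P.level j k) := by
    have hsub : (⋃ i ∈ I, Eᶜ ∩ P.level (j + 1) (P.offset j i + k)) ⊆ Eᶜ ∩ P.level j k := by
      refine Set.iUnion₂_subset fun i hi => Set.inter_subset_inter_right _ ?_
      exact level_succ_subset (Finset.mem_range.1 (Finset.mem_filter.1 hi).1) hk
    refine le_trans ?_ (measureReal_mono hsub hfin)
    rw [measureReal_biUnion_finset ?_ ?_ fun i hi => measure_ne_top_of_subset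
      Set.inter_subset_right (P.measure_level_ne_top (hlt i hi))]
    · rw [← hcard, ← nsmul_eq_mul]
      refine Finset.card_nsmul_le_sum _ _ _ fun i hi => ?_
      rw [measureReal_def, lebesgueOn_inter_level_of_modEq hP hE.compl hinv' (hlt i hi) hq
        (hmod i hi)]
      exact hqE.le
    · intro i hi i' hi' hii
      refine (P.disjoint_level (hlt i hi) (hlt i' hi') fun h => hii ?_).mono
        Set.inter_subset_right Set.inter_subset_right
      exact (P.offset_add_inj (by omega) (by omega) h).1
    · exact fun i _ => hE.compl.inter (P.measurableSet_level _ _)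
  have hsum : μ.real (E ∩ P.level j k) + μ.real (Eᶜ ∩ P.level j k) = P.width j := by
    have := measureReal_inter_add_sdiff (μ := μ) (s := P.level j k) hE (P.measure_level_ne_top hk)
    rw [Set.inter_comm, Set.sdiff_eq, Set.inter_comm _ Eᶜ] at this
    rw [this, measureReal_def, P.lebesgueOn_level hk, ENNReal.toReal_ofReal (P.width_pos j).le]
  have hw := P.r_mul_width_succ j
  rw [ht] at hw
  push_cast at hw
  have : (1 : ℝ) / (2 * N) * P.width j = t * (1 / 2 * P.width (j + 1)) := by
    rw [← hw]; field_simp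
  linarith

end RankOneParams

/-! ### Limits of powers of Koopman operators -/

section Koopman

variable {X : Type*} [MeasurableSpace X] {μ : Measure X} {T : X → X}

theorem inner_indicatorConstLp_one_one {A B : Set X} (hA : MeasurableSet A) (hB : MeasurableSet B)
    (hμA : μ A ≠ ⊤) (hμB : μ B ≠ ⊤) :
    inner ℝ (indicatorConstLp 2 hA hμA (1 : ℝ)) (indicatorConstLp 2 hB hμB (1 : ℝ)) =
      μ.real (A ∩ B) := by
  rw [L2.inner_indicatorConstLp_indicatorConstLp hA hB hμA hμB]
  simp

theorem koopman_pow_apply (hT : MeasurePreserving T μ μ) (n : ℕ) (f : Lp ℝ 2 μ) :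
    (koopman ℝ T hT ^ n) f = Lp.compMeasurePreserving T^[n] (hT.iterate n) f := by
  rw [← Lp.compMeasurePreserving_iterate]
  induction n with
  | zero => rfl
  | succ n ih =>
    rw [pow_succ', mul_apply_eq_comp, Function.iterate_succ_apply', ih]
    rfl

theorem koopman_pow_indicatorConstLp (hT : MeasurePreserving T μ μ) (n : ℕ) {A : Set X}
    (hA : MeasurableSet A) (hμA : μ A ≠ ⊤) :
    (koopman ℝ T hT ^ n) (indicatorConstLp 2 hA hμA (1 : ℝ)) =
      indicatorConstLp 2 ((hT.iterate n).measurable hA)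
        (by rwa [(hT.iterate n).measure_preimage hA.nullMeasurableSet]) (1 : ℝ) := by
  rw [koopman_pow_apply, Lp.indicatorConstLp_compMeasurePreserving]

theorem norm_koopman_pow (hT : MeasurePreserving T μ μ) (n : ℕ) (f : Lp ℝ 2 μ) :
    ‖(koopman ℝ T hT ^ n) f‖ = ‖f‖ := by
  rw [koopman_pow_apply, Lp.norm_compMeasurePreserving]

variable {ι : Type*} {l : Filter ι} {n : ι → ℕ}

/-- Powers of an isometry are equicontinuous, so convergence on a set with dense span is enough. -/
theorem tendstoId_of_dense (hT : MeasurePreserving T μ μ) {s : Set (Lp ℝ 2 μ)}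
    (hs : (Submodule.span ℝ s).topologicalClosure = ⊤)
    (h : ∀ f ∈ s, Tendsto (fun i => (koopman ℝ T hT ^ n i) f) l (𝓝 f)) :
    TendstoId T hT n l := by
  have hspan : ∀ f ∈ Submodule.span ℝ s,
      Tendsto (fun i => (koopman ℝ T hT ^ n i) f) l (𝓝 f) := by
    intro f hf
    induction hf using Submodule.span_induction with
    | mem f hf => exact h f hf
    | zero => simpa only [map_zero] using tendsto_const_nhds
    | add f g _ _ hf hg => simpa only [map_add] using hf.add hg
    | smul a f _ hf => simpa only [map_smul] using hf.const_smul a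
  intro f
  have hf : f ∈ closure (Submodule.span ℝ s : Set (Lp ℝ 2 μ)) := by
    rw [← Submodule.topologicalClosure_coe, hs]; trivial
  refine Metric.tendsto_nhds.2 fun ε hε => ?_
  obtain ⟨g, hg, hfg⟩ := Metric.mem_closure_iff.1 hf (ε / 3) (by positivity)
  filter_upwards [Metric.tendsto_nhds.1 (hspan g hg) (ε / 3) (by positivity)] with i hi
  have h1 : dist ((koopman ℝ T hT ^ n i) f) ((koopman ℝ T hT ^ n i) g) = dist f g := by
    rw [dist_eq_norm, ← map_sub, norm_koopman_pow, dist_eq_norm]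
  calc dist ((koopman ℝ T hT ^ n i) f) f
      ≤ dist ((koopman ℝ T hT ^ n i) f) ((koopman ℝ T hT ^ n i) g) +
        dist ((koopman ℝ T hT ^ n i) g) g + dist g f := dist_triangle4 _ _ _ _
    _ < ε := by rw [h1, dist_comm g f]; linarith

theorem tendstoWeaklySmul_of_dense (hT : MeasurePreserving T μ μ) {a : ℝ} {s : Set (Lp ℝ 2 μ)}
    (hs : (Submodule.span ℝ s).topologicalClosure = ⊤)
    (h : ∀ f ∈ s, ∀ g ∈ s,
      Tendsto (fun i => inner ℝ ((koopman ℝ T hT ^ n i) f) g) l (𝓝 (a * inner ℝ f g))) :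
    TendstoWeaklySmul T hT n l a := by
  -- One-sided extension for a bounded family of vectors. It is applied twice, once in each argument
  -- of the inner product.
  have key : ∀ (F : ι → Lp ℝ 2 μ) (f : Lp ℝ 2 μ) (C : ℝ), (∀ i, ‖F i‖ ≤ C) →
      (∀ g ∈ s, Tendsto (fun i => inner ℝ (F i) g) l (𝓝 (a * inner ℝ f g))) →
      ∀ g, Tendsto (fun i => inner ℝ (F i) g) l (𝓝 (a * inner ℝ f g)) := by
    intro F f C hC hF g
    have hspan : ∀ g ∈ Submodule.span ℝ s,
        Tendsto (fun i => inner ℝ (F i) g) l (𝓝 (a * inner ℝ f g)) := by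
      intro g hg
      induction hg using Submodule.span_induction with
      | mem g hg => exact hF g hg
      | zero => simpa only [inner_zero_right, mul_zero] using tendsto_const_nhds
      | add g g' _ _ hg hg' => simpa only [inner_add_right, mul_add] using hg.add hg'
      | smul b g _ hg =>
        simpa only [inner_smul_right, mul_left_comm a b] using hg.const_mul b
    have hg : g ∈ closure (Submodule.span ℝ s : Set (Lp ℝ 2 μ)) := by
      rw [← Submodule.topologicalClosure_coe, hs]; trivial
    refine Metric.tendsto_nhds.2 fun ε hε => ?_
    set D := |C| + |a| * ‖f‖ + 1 with hD
    have hD0 : 0 < D := by positivity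
    obtain ⟨g', hg', hgg⟩ := Metric.mem_closure_iff.1 hg (ε / (2 * D)) (by positivity)
    filter_upwards [Metric.tendsto_nhds.1 (hspan g' hg') (ε / 2) (by positivity)] with i hi
    rw [Real.dist_eq] at hi ⊢
    rw [dist_eq_norm] at hgg
    have e : inner ℝ (F i) g - a * inner ℝ f g = (inner ℝ (F i) g' - a * inner ℝ f g') +
        (inner ℝ (F i) (g - g') - a * inner ℝ f (g - g')) := by
      rw [inner_sub_right, inner_sub_right]; ring
    have h1 : |inner ℝ (F i) (g - g') - a * inner ℝ f (g - g')| ≤ D * ‖g - g'‖ := by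
      have h2 : |inner ℝ (F i) (g - g')| ≤ |C| * ‖g - g'‖ :=
        (abs_real_inner_le_norm _ _).trans
          (mul_le_mul_of_nonneg_right ((hC i).trans (le_abs_self C)) (norm_nonneg _))
      have h3 : |a * inner ℝ f (g - g')| ≤ |a| * ‖f‖ * ‖g - g'‖ := by
        rw [abs_mul, mul_assoc]
        exact mul_le_mul_of_nonneg_left (abs_real_inner_le_norm _ _) (abs_nonneg a)
      calc _ ≤ |inner ℝ (F i) (g - g')| + |a * inner ℝ f (g - g')| := abs_sub _ _
        _ ≤ |C| * ‖g - g'‖ + |a| * ‖f‖ * ‖g - g'‖ := add_le_add h2 h3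
        _ ≤ D * ‖g - g'‖ := by rw [hD]; nlinarith [norm_nonneg (g - g')]
    have h4 : D * ‖g - g'‖ < ε / 2 := by
      calc D * ‖g - g'‖ < D * (ε / (2 * D)) := mul_lt_mul_of_pos_left hgg hD0
        _ = ε / 2 := by field_simp
    rw [e]
    calc _ ≤ _ := abs_add_le _ _
      _ < ε := by linarith
  -- Passing to adjoints moves the powers to the fixed vector `g`, so the one-sided extension
  -- applies to the first argument.
  have h1 : ∀ g ∈ s, ∀ f,
      Tendsto (fun i => inner ℝ ((koopman ℝ T hT ^ n i) f) g) l (𝓝 (a * inner ℝ f g)) := by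
    intro g hg f
    have := key (fun i => ContinuousLinearMap.adjoint (koopman ℝ T hT ^ n i) g) g ‖g‖
      (fun i => ?_) (fun f hf => ?_) f
    · refine (this.congr fun i => ?_).trans_eq ?_
      · rw [ContinuousLinearMap.adjoint_inner_left, real_inner_comm]
      · rw [real_inner_comm]
    · refine (ContinuousLinearMap.le_opNorm _ _).trans (mul_le_of_le_one_left (norm_nonneg _) ?_)
      rw [LinearIsometryEquiv.norm_map]
      exact ContinuousLinearMap.opNorm_le_bound _ zero_le_one fun x => by
        rw [norm_koopman_pow, one_mul]
    · refine ((h f hf g hg).congr fun i => ?_).trans_eq ?_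
      · rw [ContinuousLinearMap.adjoint_inner_left, real_inner_comm]
      · rw [real_inner_comm]
  intro f g
  exact key _ f ‖f‖ (fun i => (norm_koopman_pow hT _ f).le) (fun g hg => h1 g hg f) g

end Koopman

/-! ### Limits of powers, tested on floors -/

namespace RankOneParams

variable {P : RankOneParams}

/-- The indicator functions of the floors. -/
def levelIndicators (P : RankOneParams) : Set (Lp ℝ 2 (lebesgueOn P.space)) :=
  {f | ∃ j k, ∃ hk : k < P.h j,
    f = indicatorConstLp 2 (P.measurableSet_level j k) (P.measure_level_ne_top hk) 1}

theorem topologicalClosure_span_levelIndicators :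
    (Submodule.span ℝ P.levelIndicators).topologicalClosure = ⊤ := by
  rw [Submodule.topologicalClosure_eq_top_iff, Submodule.eq_bot_iff]
  intro g hg
  refine eq_zero_of_forall_setIntegral_level_eq_zero g fun j k hk => ?_
  rw [← L2.inner_indicatorConstLp_one (𝕜 := ℝ) (P.measurableSet_level j k)
    (P.measure_level_ne_top hk)]
  exact (Submodule.mem_orthogonal _ _).1 hg _ (Submodule.subset_span ⟨j, k, hk, rfl⟩)

variable (hP : ∃ᶠ j in atTop, 0 < P.s j (P.r j - 1))

/-- For an isometry `U` one has `‖U f - f‖² = 2 (⟨f, f⟩ - ⟨U f, f⟩)`, so convergence of the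
correlations to `⟨f, f⟩` gives strong convergence. -/
theorem tendstoId_of_measure {l : Filter ℕ} {n : ℕ → ℕ}
    (h : ∀ j k, k < P.h j → Tendsto (fun i => (lebesgueOn P.space).real
      ((transformation hP)^[n i] ⁻¹' P.level j k ∩ P.level j k)) l
        (𝓝 ((lebesgueOn P.space).real (P.level j k)))) :
    TendstoId (transformation hP) (measurePreserving_transformation hP) n l := by
  refine tendstoId_of_dense _ topologicalClosure_span_levelIndicators ?_
  rintro _ ⟨j, k, hk, rfl⟩
  set f : Lp ℝ 2 (lebesgueOn P.space) :=
    indicatorConstLp 2 (P.measurableSet_level j k) (P.measure_level_ne_top hk) 1 with hf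
  set U := koopman ℝ (transformation hP) (measurePreserving_transformation hP)
  have hff : inner ℝ f f = (lebesgueOn P.space).real (P.level j k) := by
    rw [hf, inner_indicatorConstLp_one_one, Set.inter_self]
  have hUf : ∀ i, inner ℝ ((U ^ n i) f) f = (lebesgueOn P.space).real
      ((transformation hP)^[n i] ⁻¹' P.level j k ∩ P.level j k) := fun i => by
    rw [hf, koopman_pow_indicatorConstLp, inner_indicatorConstLp_one_one]
  have hsq : ∀ i, ‖(U ^ n i) f - f‖ ^ 2 = 2 * (inner ℝ f f - inner ℝ ((U ^ n i) f) f) := fun i => by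
    rw [@norm_sub_sq_real, norm_koopman_pow, real_inner_self_eq_norm_sq]
    ring
  rw [tendsto_iff_norm_sub_tendsto_zero]
  have h0 : Tendsto (fun i => ‖(U ^ n i) f - f‖ ^ 2) l (𝓝 0) := by
    simp only [hsq, hff, hUf]
    have := ((h j k hk).const_sub ((lebesgueOn P.space).real (P.level j k))).const_mul 2
    simpa using this
  have := h0.sqrt
  simpa [Real.sqrt_sq] using this

theorem tendstoWeaklySmul_of_measure {l : Filter ℕ} {n : ℕ → ℕ} {a : ℝ}
    (h : ∀ j k, k < P.h j → ∀ j' k', k' < P.h j' → Tendsto (fun i => (lebesgueOn P.space).real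
      ((transformation hP)^[n i] ⁻¹' P.level j k ∩ P.level j' k')) l
        (𝓝 (a * (lebesgueOn P.space).real (P.level j k ∩ P.level j' k')))) :
    TendstoWeaklySmul (transformation hP) (measurePreserving_transformation hP) n l a := by
  refine tendstoWeaklySmul_of_dense _ topologicalClosure_span_levelIndicators ?_
  rintro _ ⟨j, k, hk, rfl⟩ _ ⟨j', k', hk', rfl⟩
  refine ((h j k hk j' k' hk').congr fun i => ?_).trans_eq ?_
  · rw [koopman_pow_indicatorConstLp, inner_indicatorConstLp_one_one]
  · rw [inner_indicatorConstLp_one_one]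

/-! ### The action of `T ^ h j` on the columns of tower `j` -/

variable (P) in
/-- The union of the floors of tower `j` with numbers in `Q`. -/
def levels (j : ℕ) (Q : Finset ℕ) : Set P.space := ⋃ k ∈ Q, P.level j k

variable (P) in
/-- The part of the union of the floors with numbers in `Q` that lies in the columns with numbers
in `I`. -/
def columnLevels (j : ℕ) (I Q : Finset ℕ) : Set P.space :=
  ⋃ n ∈ I ×ˢ Q, P.level (j + 1) (P.offset j n.1 + n.2)

theorem mem_levels {j : ℕ} {Q : Finset ℕ} {x : P.space} :
    x ∈ P.levels j Q ↔ ∃ k ∈ Q, x ∈ P.level j k := by simp [levels]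

theorem mem_columnLevels {j : ℕ} {I Q : Finset ℕ} {x : P.space} :
    x ∈ P.columnLevels j I Q ↔ ∃ i ∈ I, ∃ k ∈ Q, x ∈ P.level (j + 1) (P.offset j i + k) := by
  simp only [columnLevels, Set.mem_iUnion, Finset.mem_product, Prod.exists, exists_prop]
  exact ⟨fun ⟨i, k, ⟨hi, hk⟩, hx⟩ => ⟨i, hi, k, hk, hx⟩, fun ⟨i, hi, k, hk, hx⟩ =>
    ⟨i, k, ⟨hi, hk⟩, hx⟩⟩

/-- Allows a fixed floor to be tested in any later tower, where the action of `T ^ h j` is explicit.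
-/
theorem exists_level_eq_levels {j j' k : ℕ} (hj : j ≤ j') (hk : k < P.h j) :
    ∃ Q : Finset ℕ, (∀ q ∈ Q, q < P.h j') ∧ P.level j k = P.levels j' Q := by
  induction j', hj using Nat.le_induction with
  | base => exact ⟨{k}, by simpa using hk, by simp [levels]⟩
  | succ j' _ ih =>
    obtain ⟨Q, hQ, he⟩ := ih
    refine ⟨(Finset.range (P.r j') ×ˢ Q).image fun n => P.offset j' n.1 + n.2, ?_, ?_⟩
    · simp only [Finset.mem_image, Finset.mem_product, Finset.mem_range, Prod.exists]
      rintro _ ⟨i, q, ⟨hi, hq⟩, rfl⟩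
      exact P.offset_add_lt hi (by have := hQ q hq; omega)
    · rw [he]
      ext x
      simp only [mem_levels, Finset.mem_image, Finset.mem_product, Finset.mem_range, Prod.exists]
      constructor
      · rintro ⟨q, hq, hx⟩
        obtain ⟨i, hi, hxi⟩ := P.exists_mem_floor_succ (hQ q hq) hx
        exact ⟨_, ⟨i, q, ⟨hi, hq⟩, rfl⟩, hxi⟩
      · rintro ⟨_, ⟨i, q, ⟨hi, hq⟩, rfl⟩, hx⟩
        exact ⟨q, hq, level_succ_subset hi (hQ q hq) hx⟩

theorem levels_inter_levels {j : ℕ} {Q Q' : Finset ℕ} (hQ : ∀ q ∈ Q, q < P.h j)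
    (hQ' : ∀ q ∈ Q', q < P.h j) : P.levels j Q ∩ P.levels j Q' = P.levels j (Q ∩ Q') := by
  ext x
  simp only [Set.mem_inter_iff, mem_levels, Finset.mem_inter]
  constructor
  · rintro ⟨⟨q, hq, hx⟩, q', hq', hx'⟩
    obtain rfl := P.eq_of_mem_floor (hQ q hq) (hQ' q' hq') hx hx'
    exact ⟨q, ⟨hq, hq'⟩, hx⟩
  · rintro ⟨q, ⟨hq, hq'⟩, hx⟩
    exact ⟨⟨q, hq, hx⟩, q, hq', hx⟩

theorem measureReal_levels {j : ℕ} {Q : Finset ℕ} (hQ : ∀ q ∈ Q, q < P.h j) :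
    (lebesgueOn P.space).real (P.levels j Q) = Q.card * P.width j := by
  rw [measureReal_def, levels, P.lebesgueOn_biUnion_level Q hQ, ENNReal.toReal_mul,
    ENNReal.toReal_natCast, ENNReal.toReal_ofReal (P.width_pos j).le]

theorem measureReal_columnLevels {j : ℕ} {I Q : Finset ℕ} (hI : ∀ i ∈ I, i < P.r j)
    (hQ : ∀ q ∈ Q, q < P.h j) :
    (lebesgueOn P.space).real (P.columnLevels j I Q) = I.card * Q.card * P.width (j + 1) := by
  have h : P.columnLevels j I Q =
      P.levels (j + 1) ((I ×ˢ Q).image fun n => P.offset j n.1 + n.2) := by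
    ext x
    simp only [mem_columnLevels, mem_levels, Finset.mem_image, Finset.mem_product, Prod.exists]
    exact ⟨fun ⟨i, hi, k, hk, hx⟩ => ⟨_, ⟨i, k, ⟨hi, hk⟩, rfl⟩, hx⟩,
      fun ⟨_, ⟨i, k, ⟨hi, hk⟩, rfl⟩, hx⟩ => ⟨i, hi, k, hk, hx⟩⟩
  rw [h, measureReal_levels, Finset.card_image_of_injOn, Finset.card_product]
  · push_cast; ring
  · rintro ⟨i, k⟩ hik ⟨i', k'⟩ hik' h
    simp only [Finset.coe_product, Set.mem_prod, Finset.mem_coe] at hik hik'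
    have h1 := hQ _ hik.2
    have h2 := hQ _ hik'.2
    obtain ⟨rfl, rfl⟩ := P.offset_add_inj (by omega) (by omega) h
    rfl
  · simp only [Finset.mem_image, Finset.mem_product, Prod.exists]
    rintro _ ⟨i, k, ⟨hi, hk⟩, rfl⟩
    have := hQ k hk
    exact P.offset_add_lt (hI i hi) (by omega)

/-- With no spacers above column `i`, its floor `k` lies exactly `P.h j` floors below floor `k` of
column `i + 1`. -/
theorem iterate_height_mem_level {j i k : ℕ} (hi : i + 1 < P.r j) (hs : P.s j i = 0)
    (hk : k < P.h j) {x : P.space} (hx : x ∈ P.level (j + 1) (P.offset j i + k)) :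
    (transformation hP)^[P.h j] x ∈ P.level j k := by
  have e : P.offset j (i + 1) + k = P.offset j i + k + P.h j := by
    rw [offset_succ, hs]; ring
  refine level_succ_subset hi hk ?_
  rw [e]
  refine iterate_mem_level hP ?_ hx
  rw [← e]
  exact P.offset_add_lt hi (by omega)

/-- From floor `k` of the column one arrives at position `k + P.h j`, at least `P.h j` and still
below the end of the block: this is a spacer, so it lies on no floor of tower `j`. -/
theorem iterate_height_notMem_levels {j i k : ℕ} (hi : i < P.r j) (hs : P.h j ≤ P.s j i)
    (hk : k < P.h j) {x : P.space} (hx : x ∈ P.level (j + 1) (P.offset j i + k)) {Q : Finset ℕ}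
    (hQ : ∀ q ∈ Q, q < P.h j) : (transformation hP)^[P.h j] x ∉ P.levels j Q := by
  rw [mem_levels]
  rintro ⟨q, hq, hxq⟩
  have hlt : P.offset j i + (k + P.h j) < P.h (j + 1) := P.offset_add_lt hi (by omega)
  have h1 := iterate_mem_level hP (by omega) hx (n := P.h j)
  obtain ⟨i', hi', h2⟩ := P.exists_mem_floor_succ (hQ q hq) hxq
  have hq' := hQ q hq
  have h3 := P.eq_of_mem_floor (by omega) (P.offset_add_lt hi' (by omega)) h1 h2
  rw [add_assoc] at h3
  have := (P.offset_add_inj (by omega) (by omega) h3).2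
  omega

/-- Only the last column may fail to return, and it is the fraction `1 / P.r j` of each floor. -/
theorem le_measureReal_iterate_height_preimage {j : ℕ} {Q : Finset ℕ}
    (hQ : ∀ q ∈ Q, q < P.h j) (hs : ∀ i < P.r j, P.s j i = 0) :
    (1 - (P.r j : ℝ)⁻¹) * (lebesgueOn P.space).real (P.levels j Q) ≤
      (lebesgueOn P.space).real ((transformation hP)^[P.h j] ⁻¹' P.levels j Q ∩ P.levels j Q) := by
  have hI : ∀ i ∈ Finset.range (P.r j - 1), i + 1 < P.r j := fun i hi => by
    have := Finset.mem_range.1 hi; omega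
  have hsub : P.columnLevels j (Finset.range (P.r j - 1)) Q ⊆
      (transformation hP)^[P.h j] ⁻¹' P.levels j Q ∩ P.levels j Q := by
    intro x hx
    obtain ⟨i, hi, k, hk, hx⟩ := mem_columnLevels.1 hx
    have hir := hI i hi
    exact ⟨mem_levels.2 ⟨k, hk, iterate_height_mem_level hP hir (hs i (by omega)) (hQ k hk) hx⟩,
      mem_levels.2 ⟨k, hk, level_succ_subset (by omega) (hQ k hk) hx⟩⟩
  refine le_trans (le_of_eq ?_) (measureReal_mono hsub ?_)
  · rw [measureReal_levels hQ, measureReal_columnLevels (fun i hi => by have := hI i hi; omega) hQ,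
      Finset.card_range, Nat.cast_sub (P.r_pos j), ← P.r_mul_width_succ j]
    have : (P.r j : ℝ) ≠ 0 := Nat.cast_ne_zero.2 (P.r_pos j).ne'
    field_simp
    push_cast
    ring
  · refine measure_ne_top_of_subset Set.inter_subset_right ?_
    rw [levels, P.lebesgueOn_biUnion_level Q hQ]
    exact ENNReal.mul_ne_top (ENNReal.natCast_ne_top _) ENNReal.ofReal_ne_top

/-- The first `m` columns return to their own floors and the others go into spacers. The last column
also has spacers, so there is no boundary term and the equality is exact. -/
theorem measureReal_iterate_height_preimage {j m : ℕ} {Q Q' : Finset ℕ}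
    (hQ : ∀ q ∈ Q, q < P.h j) (hQ' : ∀ q ∈ Q', q < P.h j) (hr : P.r j = 2 * m)
    (hs : ∀ i < m, P.s j i = 0) (hs' : ∀ i, m ≤ i → i < 2 * m → P.s j i = P.h j) :
    (lebesgueOn P.space).real ((transformation hP)^[P.h j] ⁻¹' P.levels j Q ∩ P.levels j Q') =
      1 / 2 * (lebesgueOn P.space).real (P.levels j Q ∩ P.levels j Q') := by
  have hQQ : ∀ q ∈ Q ∩ Q', q < P.h j := fun q hq => hQ q (Finset.mem_inter.1 hq).1
  have e : (transformation hP)^[P.h j] ⁻¹' P.levels j Q ∩ P.levels j Q' =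
      P.columnLevels j (Finset.range m) (Q ∩ Q') := by
    ext x
    rw [mem_columnLevels, Set.mem_inter_iff, Set.mem_preimage]
    constructor
    · rintro ⟨hx, hx'⟩
      obtain ⟨k, hk, hxk⟩ := mem_levels.1 hx'
      obtain ⟨i, hi, hxi⟩ := P.exists_mem_floor_succ (hQ' k hk) hxk
      have him : i < m := by
        by_contra! him
        exact iterate_height_notMem_levels hP hi (hs' i him (by omega)).ge (hQ' k hk) hxi hQ hx
      obtain ⟨q, hq, hxq⟩ := mem_levels.1 hx
      have h1 := iterate_height_mem_level hP (by omega) (hs i him) (hQ' k hk) hxi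
      obtain rfl := P.eq_of_mem_floor (hQ q hq) (hQ' k hk) hxq h1
      exact ⟨i, Finset.mem_range.2 him, q, Finset.mem_inter.2 ⟨hq, hk⟩, hxi⟩
    · rintro ⟨i, hi, k, hk, hx⟩
      have him := Finset.mem_range.1 hi
      exact ⟨mem_levels.2 ⟨k, (Finset.mem_inter.1 hk).1,
        iterate_height_mem_level hP (by omega) (hs i him) (hQQ k hk) hx⟩,
        mem_levels.2 ⟨k, (Finset.mem_inter.1 hk).2, level_succ_subset (by omega) (hQQ k hk) hx⟩⟩
  rw [e, levels_inter_levels hQ hQ', measureReal_levels hQQ,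
    measureReal_columnLevels (fun i hi => by have := Finset.mem_range.1 hi; omega) hQQ,
    Finset.card_range, ← P.r_mul_width_succ j, hr]
  push_cast
  ring

theorem tendstoId_height {J : Set ℕ} (hs : ∀ j ∈ J, ∀ i < P.r j, P.s j i = 0) :
    TendstoId (transformation hP) (measurePreserving_transformation hP) P.h (atTop ⊓ 𝓟 J) := by
  refine tendstoId_of_measure hP fun j₀ k₀ hk₀ => ?_
  have hlim : Tendsto (fun j => (1 - (P.r j : ℝ)⁻¹) * (lebesgueOn P.space).real (P.level j₀ k₀))
      (atTop ⊓ 𝓟 J) (𝓝 ((lebesgueOn P.space).real (P.level j₀ k₀))) := by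
    have h1 : Tendsto (fun j => (P.r j : ℝ)⁻¹) atTop (𝓝 0) :=
      tendsto_inv_atTop_zero.comp (tendsto_natCast_atTop_atTop.comp P.r_tendsto)
    have h2 := (h1.const_sub 1).mul_const ((lebesgueOn P.space).real (P.level j₀ k₀))
    rw [sub_zero, one_mul] at h2
    exact h2.mono_left inf_le_left
  refine tendsto_of_tendsto_of_tendsto_of_le_of_le' hlim tendsto_const_nhds ?_
    (Eventually.of_forall fun j => measureReal_mono Set.inter_subset_right
      (P.measure_level_ne_top hk₀))
  rw [eventually_inf_principal]
  filter_upwards [eventually_ge_atTop j₀] with j hj hjJ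
  obtain ⟨Q, hQ, he⟩ := exists_level_eq_levels hj hk₀
  rw [he]
  exact le_measureReal_iterate_height_preimage hP hQ (hs j hjJ)

theorem tendstoWeaklySmul_height {J : Set ℕ} (hr : ∀ j ∈ J, P.r j = 2 * (j + 1) ∧
    (∀ i < j + 1, P.s j i = 0) ∧ ∀ i, j + 1 ≤ i → i < 2 * (j + 1) → P.s j i = P.h j) :
    TendstoWeaklySmul (transformation hP) (measurePreserving_transformation hP) P.h
      (atTop ⊓ 𝓟 J) (1 / 2) := by
  refine tendstoWeaklySmul_of_measure hP fun j₀ k₀ hk₀ j₁ k₁ hk₁ => ?_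
  refine tendsto_const_nhds.congr' ?_
  refine eventually_inf_principal.2 ?_
  filter_upwards [eventually_ge_atTop j₀, eventually_ge_atTop j₁] with j hj₀ hj₁ hjJ
  obtain ⟨Q, hQ, he⟩ := exists_level_eq_levels hj₀ hk₀
  obtain ⟨Q', hQ', he'⟩ := exists_level_eq_levels hj₁ hk₁
  obtain ⟨h1, h2, h3⟩ := hr j hjJ
  rw [he, he', measureReal_iterate_height_preimage hP hQ hQ' h1 h2 h3]

end RankOneParams

/-! ### The parameters -/

section Parameters

open Classical in
/-- The number of columns at stage `j`. -/
def stageColumns (J J' : Set ℕ) (j : ℕ) : ℕ :=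
  -- At a stage in `J` any choice tending to infinity would do. The factorial at a free stage is
  -- divisible by all `N ≤ j + 2`.
  if j ∈ J then j + 2 else if j ∈ J' then 2 * (j + 1) else (j + 2).factorial

open Classical in
/-- The number of spacers above the `i`-th column at stage `j`, if the tower has height `n`. -/
def stageSpacers (J J' : Set ℕ) (j n i : ℕ) : ℕ :=
  if j ∈ J then 0 else if j ∈ J' then (if i < j + 1 then 0 else n)
  -- A tower of height `n` with these spacers has height `n (j + 2)! + 1`, which is congruent to `1`
  -- modulo all `N ≤ j + 2`.
  else n * ((j + 2).factorial - 1) + 1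

/-- The heights of the towers. -/
def stageHeight (J J' : Set ℕ) : ℕ → ℕ
  | 0 => 1
  | j + 1 => stageHeight J J' j * stageColumns J J' j +
      ∑ i ∈ Finset.range (stageColumns J J' j), stageSpacers J J' j (stageHeight J J' j) i

theorem lt_stageColumns (J J' : Set ℕ) (j : ℕ) : j < stageColumns J J' j := by
  unfold stageColumns
  split_ifs
  · omega
  · omega
  · have := Nat.self_le_factorial (j + 2)
    omega

/-- The stages in `J` are rigid, those in `J'` give the weak limit `1 / 2`, and the other ones
give total ergodicity. -/
def stageParams (J J' : Set ℕ) : RankOneParams where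
  h₀ := 1
  r := stageColumns J J'
  s j i := stageSpacers J J' j (stageHeight J J' j) i
  h₀_pos := one_pos
  r_pos j := (Nat.zero_le j).trans_lt (lt_stageColumns J J' j)
  r_tendsto := tendsto_atTop_mono (fun j => (lt_stageColumns J J' j).le) tendsto_id

variable {J J' : Set ℕ}

/-- The spacers depend on the heights, while `RankOneParams.h` is available only once the spacers
are given. The circle is broken by computing the heights in advance, and this lemma identifies the
two. -/
theorem stageParams_h (j : ℕ) : (stageParams J J').h j = stageHeight J J' j := by
  induction j with
  | zero => rfl
  | succ j ih =>
    rw [RankOneParams.h, ih]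
    rfl

theorem stageParams_s_of_mem {j : ℕ} (hj : j ∈ J) (i : ℕ) : (stageParams J J').s j i = 0 :=
  if_pos hj

theorem stageParams_of_mem_right (hJ : Disjoint J' J) {j : ℕ} (hj : j ∈ J') :
    (stageParams J J').r j = 2 * (j + 1) ∧ (∀ i < j + 1, (stageParams J J').s j i = 0) ∧
      ∀ i, j + 1 ≤ i → i < 2 * (j + 1) → (stageParams J J').s j i = (stageParams J J').h j := by
  have hjJ : j ∉ J := Set.disjoint_left.1 hJ hj
  refine ⟨?_, fun i hi => ?_, fun i hi _ => ?_⟩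
  · simp only [stageParams, stageColumns, if_neg hjJ, if_pos hj]
  · simp only [stageParams, stageSpacers, if_neg hjJ, if_pos hj, if_pos hi]
  · rw [stageParams_h]
    simp only [stageParams, stageSpacers, if_neg hjJ, if_pos hj, if_neg hi.not_gt]

theorem stageParams_r_of_notMem {j : ℕ} (hj : j ∉ J) (hj' : j ∉ J') :
    (stageParams J J').r j = (j + 2).factorial := by
  simp only [stageParams, stageColumns, if_neg hj, if_neg hj']

theorem stageParams_s_of_notMem {j : ℕ} (hj : j ∉ J) (hj' : j ∉ J') (i : ℕ) :
    (stageParams J J').s j i = (stageParams J J').h j * ((j + 2).factorial - 1) + 1 := by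
  rw [stageParams_h]
  simp only [stageParams, stageSpacers, if_neg hj, if_neg hj']

theorem stageParams_offset_of_notMem {j : ℕ} (hj : j ∉ J) (hj' : j ∉ J') (i : ℕ) :
    (stageParams J J').offset j i =
      i * ((stageParams J J').h j * (j + 2).factorial + 1) := by
  obtain ⟨n, hn⟩ := Nat.exists_eq_add_of_le' (Nat.factorial_pos (j + 2))
  simp only [RankOneParams.offset, stageParams_s_of_notMem hj hj', Finset.sum_const,
    Finset.card_range, smul_eq_mul, hn, Nat.add_sub_cancel]
  ring

theorem frequently_stageParams_s_pos (hinf : (J ∪ J')ᶜ.Infinite) :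
    ∃ᶠ j in atTop, 0 < (stageParams J J').s j ((stageParams J J').r j - 1) := by
  refine (Nat.frequently_atTop_iff_infinite.2 hinf).mono fun j hj => ?_
  rw [Set.mem_union, not_or] at hj
  rw [stageParams_s_of_notMem hj.1 hj.2]
  exact Nat.succ_pos _

/-- Column `i` starts at `i (h_j (j + 2)! + 1)`, and `N` divides `(j + 2)!` as soon as `j ≥ N`. This
is the hypothesis for ergodicity of `T^N`. -/
theorem frequently_stageParams_offset_modEq (hinf : (J ∪ J')ᶜ.Infinite) {N : ℕ} (hN : 0 < N) :
    ∃ᶠ j in atTop, N ∣ (stageParams J J').r j ∧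
      ∀ i < (stageParams J J').r j, (stageParams J J').offset j i ≡ i [MOD N] := by
  refine ((Nat.frequently_atTop_iff_infinite.2 hinf).and_eventually (eventually_ge_atTop N)).mono ?_
  rintro j ⟨hj, hNj⟩
  rw [Set.mem_union, not_or] at hj
  have hdvd : N ∣ (j + 2).factorial := Nat.dvd_factorial hN (by omega)
  refine ⟨by rwa [stageParams_r_of_notMem hj.1 hj.2], fun i _ => ?_⟩
  rw [stageParams_offset_of_notMem hj.1 hj.2]
  have h1 : (stageParams J J').h j * (j + 2).factorial + 1 ≡ 0 + 1 [MOD N] :=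
    ((Nat.modEq_zero_iff_dvd).2 (hdvd.mul_left _)).add_right 1
  simpa using h1.mul_left i

end Parameters

/-! ### Growth of the heights and of the measures of the towers -/

namespace RankOneParams

variable (P : RankOneParams)

theorem h_mul_r_le (j : ℕ) : P.h j * P.r j ≤ P.h (j + 1) := Nat.le_add_right _ _

theorem one_le_h_mul_width (j : ℕ) : 1 ≤ P.h j * P.width j := by
  induction j with
  | zero => simpa [width] using Nat.succ_le_of_lt (P.h_pos 0)
  | succ j ih =>
    refine ih.trans ?_
    rw [← P.r_mul_width_succ j, ← mul_assoc]
    exact mul_le_mul_of_nonneg_right (by exact_mod_cast P.h_mul_r_le j) (P.width_pos _).le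

theorem tendsto_h : Tendsto P.h atTop atTop := by
  rw [← tendsto_add_atTop_iff_nat 1]
  refine tendsto_atTop_mono (fun j => ?_) P.r_tendsto
  exact (Nat.le_mul_of_pos_left _ (P.h_pos j)).trans (P.h_mul_r_le j)

end RankOneParams

/-- The measure of a tower never decreases and is at least `1`; a free stage multiplies it by more
than `(j + 2)!`. -/
theorem exists_le_stageParams_h_mul_width {J J' : Set ℕ} (hinf : (J ∪ J')ᶜ.Infinite) (M : ℕ) :
    ∃ j, (M : ℝ) ≤ (stageParams J J').h j * (stageParams J J').width j := by
  set P := stageParams J J' with hP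
  obtain ⟨j, hj, hMj⟩ := hinf.exists_gt M
  rw [Set.mem_compl_iff, Set.mem_union, not_or] at hj
  refine ⟨j + 1, ?_⟩
  have h1 : P.h (j + 1) = P.r j * (P.h j * (j + 2).factorial + 1) := by
    rw [← P.offset_r, hP, stageParams_offset_of_notMem hj.1 hj.2]
  have h2 : (M : ℝ) ≤ (j + 2).factorial := by
    have := Nat.self_le_factorial (j + 2)
    exact_mod_cast (show M ≤ (j + 2).factorial by omega)
  have h3 : (P.h (j + 1) : ℝ) * P.width (j + 1) =
      P.h j * P.width j * (j + 2).factorial + P.width j := by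
    rw [h1, ← P.r_mul_width_succ j]
    push_cast
    ring
  rw [h3]
  have h4 := P.one_le_h_mul_width j
  have h5 := P.width_pos j
  have h6 : ((j + 2).factorial : ℝ) ≤ P.h j * P.width j * (j + 2).factorial :=
    le_mul_of_one_le_left (by positivity) h4
  linarith

theorem tendsto_nth_atTop_inf_principal {J : Set ℕ} (hJ : J.Infinite) :
    Tendsto (Nat.nth (· ∈ J)) atTop (atTop ⊓ 𝓟 J) :=
  tendsto_inf.2 ⟨(Nat.nth_strictMono hJ).tendsto_atTop,
    tendsto_principal.2 (Eventually.of_forall fun n => Nat.nth_mem_of_infinite hJ n)⟩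

/-! ### Products with totally ergodic maps -/

section TotallyErgodic

variable {X : Type*} [MeasurableSpace X] {μ : Measure X} {T : X → X}

theorem ergodic_iterate_iterate (hT : ∀ n, 0 < n → Ergodic T^[n] μ) {p : ℕ} (hp : 0 < p) (n : ℕ)
    (hn : 0 < n) : Ergodic (T^[p])^[n] μ := by
  rw [← Function.iterate_mul]
  exact hT _ (Nat.mul_pos hp hn)

variable [SigmaFinite μ]

theorem HasSquarefreeRationalSpectrum.hasExactlyErgodicComponents_prod (hμ : μ ≠ 0)
    (hT : ∀ n, 0 < n → Ergodic T^[n] μ) {Z : Type*} [MeasurableSpace Z] {ν : Measure Z}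
    [IsProbabilityMeasure ν] {S : Z ≃ᵐ Z} (hS : HasSquarefreeRationalSpectrum S ν) {p : ℕ}
    (hp : p.Prime) : HasExactlyErgodicComponents (Prod.map S T)^[p] (ν.prod μ) p := by
  rw [Prod.map_iterate]
  exact (hS.hasExactlyErgodicComponents_iterate hp).prod hμ
    (hS.ergodic.toMeasurePreserving.iterate p) (hT p hp.pos).toMeasurePreserving
    fun E hE hinv => hS.exists_fst_preimage (ergodic_iterate_iterate hT hp.pos) p hE hinv

/-- Treated through periodic cylinders and the coordinate at `p`, without determining the spectrum
of the product of shifts. -/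
theorem hasExactlyErgodicComponents_primeShift_prod (hμ : μ ≠ 0)
    (hT : ∀ n, 0 < n → Ergodic T^[n] μ) (p : Nat.Primes) :
    HasExactlyErgodicComponents (Prod.map (primeShift Set.univ) T)^[(p : ℕ)]
      ((primeHaar Set.univ).prod μ) p := by
  rw [Prod.map_iterate]
  exact (hasExactlyErgodicComponents_primeShift_iterate p).prod hμ
    ((measurePreserving_primeShift _).iterate p) (hT p p.2.pos).toMeasurePreserving
    fun _ hE hinv => exists_fst_preimage_of_primeShift (ergodic_iterate_iterate hT p.2.pos) p hE hinv

/-- The shift is not raised to a power, so it remains ergodic, and `T^p` is again totally ergodic;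
this works for every set `Q` of primes. -/
theorem ergodic_primeShift_prod (hμ : μ ≠ 0) (hT : ∀ n, 0 < n → Ergodic T^[n] μ)
    (Q : Set Nat.Primes) {p : ℕ} (hp : 0 < p) :
    Ergodic (Prod.map (primeShift Q) T^[p]) ((primeHaar Q).prod μ) :=
  ergodic_primeShift.prod_of_fst_preimage hμ (hT p hp).toMeasurePreserving
    fun _ hE hinv => exists_fst_preimage_of_primeShift (ergodic_iterate_iterate hT hp) 1 hE hinv

end TotallyErgodic

end

/-! ### The construction for a given set of rigid stages -/

theorem mainTheorem3 (J : Set ℕ) (hJ : J.Infinite) (hJc : Jᶜ.Infinite) :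
    ∃ (J' : Set ℕ) (P : RankOneParams) (X : Set ℝ) (T : X ≃ᵐ X)
      (hT : MeasurePreserving T (lebesgueOn X) (lebesgueOn X)) (a : ℕ → ℕ → ℝ) (w : ℕ → ℝ),
      -- the two kinds of stages
      J'.Infinite ∧ Disjoint J' J ∧
      (∀ j ∈ J, ∀ i < P.r j, P.s j i = 0) ∧
      (∀ j ∈ J', P.r j = 2 * (j + 1) ∧ (∀ i < j + 1, P.s j i = 0) ∧
        ∀ i, j + 1 ≤ i → i < 2 * (j + 1) → P.s j i = P.h j) ∧
      -- `T` is the rank-one transformation with these parameters, on a space of infinite measure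
      IsRankOneConstruction P X T a w ∧
      lebesgueOn X Set.univ = ⊤ ∧
      IsSuitableBase T hT ∧
      -- limits of powers along the heights of the towers
      TendstoId T hT P.h (atTop ⊓ 𝓟 J) ∧
      TendstoWeaklySmul T hT P.h (atTop ⊓ 𝓟 J') (1 / 2) ∧
      -- products with the product `S` of all cyclic shifts, and with the product over `q ≠ p`
      ∀ p : Nat.Primes,
        HasExactlyErgodicComponents (Prod.map (primeShift Set.univ) T)^[(p : ℕ)]
          ((primeHaar Set.univ).prod (lebesgueOn X)) (p : ℕ) ∧
        Ergodic (Prod.map (primeShift {p}ᶜ) T^[(p : ℕ)])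
          ((primeHaar {p}ᶜ).prod (lebesgueOn X)) := by
  -- The complement of `J` is cut into two parts of equal cardinality, hence both infinite. `J''`
  -- provides the free stages needed for total ergodicity and infinite measure.
  obtain ⟨J', J'', hunion, hdisj, hcard⟩ :=
    hJc.exists_union_disjoint_cardinal_eq_of_infinite
  have hiff : J'.Infinite ↔ J''.Infinite := by
    rw [← Set.infinite_coe_iff, ← Set.infinite_coe_iff, Cardinal.infinite_iff,
      Cardinal.infinite_iff, hcard]
  have hor : J'.Infinite ∨ J''.Infinite := Set.infinite_union.1 (hunion ▸ hJc)
  have hinf' : J'.Infinite := hor.elim id hiff.2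
  have hinf'' : J''.Infinite := hiff.1 hinf'
  have hJJ' : Disjoint J' J :=
    (disjoint_compl_left (a := J)).mono_left (hunion ▸ Set.subset_union_left)
  have hinf : (J ∪ J')ᶜ.Infinite := hinf''.mono fun j hj h => by
    rcases h with h | h
    · exact (hunion ▸ Set.mem_union_right J' hj : j ∈ Jᶜ) h
    · exact Set.disjoint_left.1 hdisj h hj
  set P := stageParams J J'
  have hP : ∃ᶠ j in atTop, 0 < P.s j (P.r j - 1) := frequently_stageParams_s_pos hinf
  have hμ := P.lebesgueOn_space_univ (exists_le_stageParams_h_mul_width hinf)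
  have hμ0 : lebesgueOn P.space ≠ 0 := fun h => by simp [h] at hμ
  have herg : ∀ n, 0 < n → Ergodic (RankOneParams.transformation hP)^[n] (lebesgueOn P.space) :=
    fun n hn => RankOneParams.ergodic_iterate_transformation hP hn
      (frequently_stageParams_offset_modEq hinf hn)
  have hstrong := RankOneParams.tendstoId_height hP (J := J)
    fun j hj i _ => stageParams_s_of_mem hj i
  have hweak := RankOneParams.tendstoWeaklySmul_height hP (J := J')
    fun j hj => stageParams_of_mem_right hJJ' hj
  have hh : ∀ {K : Set ℕ}, K.Infinite → Tendsto (fun i => P.h (Nat.nth (· ∈ K) i)) atTop atTop :=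
    fun hK => P.tendsto_h.comp (Nat.nth_strictMono hK).tendsto_atTop
  refine ⟨J', P, P.space, RankOneParams.transformation hP,
    RankOneParams.measurePreserving_transformation hP, P.left, P.width, hinf', hJJ',
    fun j hj i _ => stageParams_s_of_mem hj i, fun j hj => stageParams_of_mem_right hJJ' hj,
    RankOneParams.isRankOneConstruction_transformation hP, hμ, ⟨?_, ?_, ?_⟩, hstrong, hweak,
    fun p => ⟨hasExactlyErgodicComponents_primeShift_prod hμ0 herg p,
      ergodic_primeShift_prod hμ0 herg _ p.2.pos⟩⟩
  · exact ⟨_, hh hJ, fun f => (hstrong f).comp (tendsto_nth_atTop_inf_principal hJ)⟩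
  · exact ⟨1 / 2, by norm_num, by norm_num, _, hh hinf',
      fun f g => (hweak f g).comp (tendsto_nth_atTop_inf_principal hinf')⟩
  · intro Z _ _ ν _ S hS p hp
    exact hS.hasExactlyErgodicComponents_prod hμ0 herg hp
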